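/- Let $W\subseteq V$ be finite-dimensional real vector spaces of smooth vector fields on $\mathbb{R}^n$ such that $[W,W]\subseteq W$ and $[W,V]\subseteq V$ (a quasi-Lie scheme $S(W,V)$), and assume that every vector field in $W$ is complete. Let $\mathcal V$ be the set of $t$-dependent vector fields on $\mathbb{R}^n$ ($t\in\mathbb R$) with values in $V$, i.e. of smooth curves $t\mapsto X_t$ in $V$. Let $\mathcal G_W$ be the group of generalised flows of $t$-dependent vector fields with values in $W$: smooth families $(g_t)_{t\in\mathbb R}$ of diffeomorphisms of $\mathbb{R}^n$ with $g_0=\mathrm{Id}$ and $\partial g_t/\partial t=Y_t\circ g_t$ for a smooth curve $Y$ in $W$. It acts on $\mathcal V$: $g_\bigstar X$ is the $t$-dependent vector field whose suspension $\partial_t+g_\bigstar X$ is the push-forward of $\partial_t+X$ under $(t,x)\mapsto(t,g_t(x))$. A map $F:\mathcal V\to C^\infty(\mathbb R)$ is a *quasi-Lie invariant* if $F(g_\bigstar X)=F(X)$ for all $g\in\mathcal G_W$ and $X\in\mathcal V$. It is a quasi-Lie invariant *of order two* if, moreover, there is a smooth function $\varphi_F$ on the second-order tangent bundle $T^2V$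 with $F(X)(t)=\varphi_F(\mathbf t^2_tX)$ for all $X\in\mathcal V$ and $t\in\mathbb R$, where $\mathbf t^2_tX$ is the second-order tangent vector at $t$ of the curve $X$. Fix a local change of parameter $t=t_0+\tau(\bar t)$, where $\tau$ is smooth, $\tau(0)=0$, $\tau'(0)\neq0$ (the same $\tau$ for all $t_0$), and put $a=\frac{dt}{d\bar t}=\tau'(0)$, $b=\frac{d^2t}{d\bar t^2}=\tau''(0)$. For $\tau=\mathrm{id}$, this is $a=1$, $b=0$. Identify $T^2V$ with $V^3$ by $\mathbf t^2_{t_0}X=\left(X_{t_0},\frac{dX}{d\bar t}(t_0),\frac{d^2X}{d\bar t^2}(t_0)\right)$. Consider on $T^2V$, for $(X,X',X'')\in V^3$: 1. the action $\mathcal J^2$ of the connected Lie group integrating $W$, $(g;(X,X',X''))\mapsto(g_*X,g_*X',g_*X'')$; its fundamental vector fields are the ones obtained from the one-parameter groups $g=\exp(sL)$ (the flows of the fields $L\in W$); 2. the action $\mathcal T^2$ of the additive group $T^2_1W=\{(0,0,Y''):Y''\in W\}$ by $(X,X',X'')\mapsto(X,X',X''+Y'')$; 3. for each $L\in W$ the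 flow $$\mathcal T_1^L(s;(X,X',X''))=(X,X',X'')+\left(sL,\,-sa[L,X],\,s^2a^2[L,[L,X]]-2sa[L,X']-sb[L,X]\right),\quad s\in\mathbb R;$$ 4. the action $\mathcal T_2$ of the additive group $T^2_0W=\{(0,Y',Y''):Y',Y''\in W\}$ by $(X,X',X'')\mapsto(X,\,Y'+X',\,-a[Y',X]+X''+Y'')$. **Theorem.** Let $F:\mathcal V\to C^\infty(\mathbb R)$ be given by $F(X)(t)=\varphi_F(\mathbf t^2_tX)$ for a smooth function $\varphi_F:T^2V\to\mathbb R$. Then $F$ is a quasi-Lie invariant of order two for $S(W,V)$ if and only if $\varphi_F$ is a common first integral of the fundamental vector fields of $\mathcal J^2$ and of $\mathcal T^2$, of the vector fields generating the flows $\mathcal T_1^L$ for all $L\in W$, and of the fundamental vector fields of $\mathcal T_2$. -/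

import Mathlib

open scoped Manifold ContDiff Topology

namespace QuasiLie

/-- The configuration space `ℝⁿ`. -/
abbrev RSpace (n : ℕ) : Type := EuclideanSpace ℝ (Fin n)

/-! ### Smooth vector fields on `ℝⁿ` -/

/-- Smooth maps `ℝⁿ → ℝⁿ`, as a real vector space. -/
def smoothMaps (n : ℕ) : Submodule ℝ (RSpace n → RSpace n) where
  carrier := {f | ContDiff ℝ ∞ f}
  add_mem' := by
    intro f g hf hg
    rw [Set.mem_ofPred_eq] at *
    exact hf.add hg
  zero_mem' := by
    rw [Set.mem_ofPred_eq]
    exact contDiff_const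
  smul_mem' := by
    intro c f hf
    rw [Set.mem_ofPred_eq] at *
    exact contDiff_const.smul hf

/-- The real vector space `𝔛(ℝⁿ)` of smooth vector fields on `ℝⁿ`
(the fibre of `T ℝⁿ` at each point is identified with `ℝⁿ`). -/
def VField (n : ℕ) : Type := smoothMaps n

namespace VField

variable {n : ℕ}

instance : AddCommGroup (VField n) := inferInstanceAs (AddCommGroup (smoothMaps n))

instance : Module ℝ (VField n) := inferInstanceAs (Module ℝ (smoothMaps n))

instance : CoeFun (VField n) (fun _ => RSpace n → RSpace n) := ⟨fun X => X.1⟩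

theorem contDiff (X : VField n) : ContDiff ℝ ∞ (X : RSpace n → RSpace n) := X.2

theorem differentiable (X : VField n) : Differentiable ℝ (X : RSpace n → RSpace n) :=
  X.contDiff.differentiable (by simp)

@[ext] theorem ext {X Y : VField n} (h : ∀ x, X x = Y x) : X = Y :=
  Subtype.ext (funext h)

@[simp] theorem add_apply (X Y : VField n) (x : RSpace n) : (X + Y) x = X x + Y x := rfl

@[simp] theorem smul_apply (c : ℝ) (X : VField n) (x : RSpace n) : (c • X) x = c • X x := rfl

@[simp] theorem zero_apply (x : RSpace n) : (0 : VField n) x = 0 := rfl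

/-- The Lie bracket of vector fields, `[X, Y] = DY(X) - DX(Y)`. -/
noncomputable instance : Bracket (VField n) (VField n) :=
  ⟨fun X Y => ⟨VectorField.lieBracket ℝ X Y, by
    have h : ContDiff ℝ ∞ (VectorField.lieBracket ℝ X Y) :=
      X.contDiff.lieBracket_vectorField Y.contDiff (m := ∞) (by simp)
    exact h⟩⟩

theorem bracket_apply (X Y : VField n) (x : RSpace n) :
    ⁅X, Y⁆ x = fderiv ℝ Y x (X x) - fderiv ℝ X x (Y x) := rfl

theorem add_bracket (X Y Z : VField n) : ⁅X + Y, Z⁆ = ⁅X, Z⁆ + ⁅Y, Z⁆ := by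
  ext1 x
  exact VectorField.lieBracket_add_left (X.differentiable x) (Y.differentiable x)

theorem smul_bracket (c : ℝ) (X Y : VField n) : ⁅c • X, Y⁆ = c • ⁅X, Y⁆ := by
  ext1 x
  exact VectorField.lieBracket_const_smul_left (X.differentiable x)

end VField

/-! ### Diffeomorphisms, generalised flows and their action -/

/-- Smooth diffeomorphisms of `ℝⁿ`. -/
abbrev Diffeo (n : ℕ) : Type := RSpace n ≃ₘ^∞⟮𝓘(ℝ, RSpace n), 𝓘(ℝ, RSpace n)⟯ RSpace n

/-- Push-forward `f_* X` of a vector field: `(f_* X)(x) = Df(f⁻¹ x) (X (f⁻¹ x))`. -/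
noncomputable def push {n : ℕ} (f : Diffeo n) (X : VField n) : VField n :=
  ⟨fun x => fderiv ℝ f (f.symm x) (X (f.symm x)), by
    have h1 : ContDiff ℝ ∞ (fderiv ℝ f) := f.contDiff.fderiv_right (by simp)
    exact (h1.comp f.symm.contDiff).clm_apply (X.contDiff.comp f.symm.contDiff)⟩

/-- `g` is the (global) generalised flow of the `t`-dependent vector field `Y`: `g₀ = id`,
`∂g_t(x)/∂t = Y_t(g_t(x))`, and the autonomisation `(t, x) ↦ (t, g_t(x))` is a
diffeomorphism of `ℝ × ℝⁿ`. -/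
structure IsGeneralisedFlow {n : ℕ} (Y : ℝ → VField n) (g : ℝ → Diffeo n) : Prop where
  smooth : ContDiff ℝ ∞ (fun p : ℝ × RSpace n => g p.1 p.2)
  smooth_symm : ContDiff ℝ ∞ (fun p : ℝ × RSpace n => (g p.1).symm p.2)
  zero : ∀ x, g 0 x = x
  ode : ∀ t x, HasDerivAt (fun s => g s x) (Y t (g t x)) t

/-- The flow of an autonomous vector field `L`: the one-parameter group `exp(sL)`. -/
abbrev IsFlow {n : ℕ} (L : VField n) (h : ℝ → Diffeo n) : Prop :=
  IsGeneralisedFlow (fun _ => L) h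

/-- A vector field is complete if its flow is globally defined. -/
def IsComplete {n : ℕ} (L : VField n) : Prop := ∃ h, IsFlow L h

/-- The autonomisation `(t, x) ↦ (t, g_t(x))`. -/
noncomputable def autonomisation {n : ℕ} (g : ℝ → Diffeo n) (p : ℝ × RSpace n) : ℝ × RSpace n :=
  (p.1, g p.1 p.2)

/-- The suspension `∂/∂t + X` on `ℝ × ℝⁿ`. -/
noncomputable def suspension {n : ℕ} (X : ℝ → VField n) (p : ℝ × RSpace n) : ℝ × RSpace n :=
  (1, X p.1 p.2)

/-- The `t`-dependent vector field `g_★ X`: the push-forward of the suspension of `X` by the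
autonomisation of `g` is the suspension of `g_★ X`. -/
noncomputable def starFun {n : ℕ} (g : ℝ → Diffeo n) (X : ℝ → VField n) (t : ℝ) (x : RSpace n) : RSpace n :=
  (fderiv ℝ (autonomisation g) (t, (g t).symm x) (suspension X (t, (g t).symm x))).2

/-! ### Quasi-Lie schemes -/

/-- A quasi-Lie scheme `S(W, V)` on `ℝⁿ`: finite-dimensional spaces of vector fields with
`[W, W] ⊆ W ⊆ V` and `[W, V] ⊆ V`. -/
structure Scheme (n : ℕ) where
  W : Submodule ℝ (VField n)
  V : Submodule ℝ (VField n)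
  finite_V : FiniteDimensional ℝ V
  le : W ≤ V
  bracket_WW : ∀ X ∈ W, ∀ Y ∈ W, ⁅X, Y⁆ ∈ W
  bracket_WV : ∀ X ∈ W, ∀ Y ∈ V, ⁅X, Y⁆ ∈ V

namespace Scheme

variable {n : ℕ} (S : Scheme n)

instance : FiniteDimensional ℝ S.V := S.finite_V

/-- `V` carries its canonical structure of a finite-dimensional normed space; the norm is the
one given by the coordinates with respect to some basis (all norms are equivalent). -/
noncomputable instance : NormedAddCommGroup S.V :=
  NormedAddCommGroup.induced S.V (Fin (Module.finrank ℝ S.V) → ℝ)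
    (Module.finBasis ℝ S.V).equivFun.toLinearMap (Module.finBasis ℝ S.V).equivFun.injective

noncomputable instance : NormedSpace ℝ S.V :=
  NormedSpace.induced ℝ S.V (Fin (Module.finrank ℝ S.V) → ℝ)
    (Module.finBasis ℝ S.V).equivFun.toLinearMap

/-- The quasi-Lie family `𝒱`: the `C^∞(ℝ)`-module of `t`-dependent vector fields with values
in `V`, i.e. of smooth curves in `V`. -/
noncomputable abbrev Family : Type := C^∞⟮𝓘(ℝ, ℝ), ℝ; 𝓘(ℝ, S.V), S.V⟯

/-- The `t`-dependent vector field on `ℝⁿ` given by an element of `𝒱`. -/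
noncomputable abbrev Family.field {S : Scheme n} (X : S.Family) : ℝ → VField n := fun t => (X t : VField n)

/-- The group `𝒢_W` of the scheme: generalised flows of `t`-dependent vector fields with
values in `W`. -/
noncomputable def groupW : Set (ℝ → Diffeo n) :=
  {g | ∃ Y : S.Family, (∀ t, Y.field t ∈ S.W) ∧ IsGeneralisedFlow Y.field g}

end Scheme

/-! ### Auxiliary facts: `V` is stable under the transformations of the scheme -/

section Aux

variable {n : ℕ} {Y : ℝ → VField n} {g : ℝ → Diffeo n}

theorem hasDerivAt_apply_const {E F : Type*} [NormedAddCommGroup E] [NormedSpace ℝ E]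
    [NormedAddCommGroup F] [NormedSpace ℝ F] {A : ℝ → E →L[ℝ] F} {A' : E →L[ℝ] F} {t : ℝ}
    (h : HasDerivAt A A' t) (v : E) : HasDerivAt (fun s => A s v) (A' v) t := by
  have := h.clm_apply (hasDerivAt_const t v)
  simpa using this

theorem hasFDerivAt_apply_const {E F G : Type*} [NormedAddCommGroup E] [NormedSpace ℝ E]
    [NormedAddCommGroup F] [NormedSpace ℝ F] [NormedAddCommGroup G] [NormedSpace ℝ G]
    {A : G → E →L[ℝ] F} {A' : G →L[ℝ] E →L[ℝ] F} {x : G}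
    (h : HasFDerivAt A A' x) (v : E) : HasFDerivAt (fun y => A y v) (A'.flip v) x := by
  have := h.clm_apply (hasFDerivAt_const v x)
  simpa using this

theorem IsGeneralisedFlow.fderiv_apply (hg : IsGeneralisedFlow Y g) (t : ℝ) (x v : RSpace n) :
    fderiv ℝ (g t) x v = fderiv ℝ (fun p : ℝ × RSpace n => g p.1 p.2) (t, x) (0, v) := by
  have h1 : HasFDerivAt (fun p : ℝ × RSpace n => g p.1 p.2)
      (fderiv ℝ (fun p : ℝ × RSpace n => g p.1 p.2) (t, x)) (t, x) :=
    (hg.smooth.differentiable (by simp) (t, x)).hasFDerivAt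
  have h2 : HasFDerivAt (fun y : RSpace n => (t, y)) (ContinuousLinearMap.inr ℝ ℝ (RSpace n)) x :=
    hasFDerivAt_prodMk_right t x
  have h3 := h1.comp x h2
  have h4 : (fun p : ℝ × RSpace n => g p.1 p.2) ∘ (fun y : RSpace n => (t, y)) = g t := rfl
  rw [h4] at h3
  rw [h3.fderiv]
  simp

theorem IsGeneralisedFlow.fderiv_time (hg : IsGeneralisedFlow Y g) (t : ℝ) (x : RSpace n) :
    fderiv ℝ (fun p : ℝ × RSpace n => g p.1 p.2) (t, x) (1, 0) = Y t (g t x) := by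
  have h1 : HasFDerivAt (fun p : ℝ × RSpace n => g p.1 p.2)
      (fderiv ℝ (fun p : ℝ × RSpace n => g p.1 p.2) (t, x)) (t, x) :=
    (hg.smooth.differentiable (by simp) (t, x)).hasFDerivAt
  have h2 : HasDerivAt (fun s : ℝ => (s, x)) ((1 : ℝ), (0 : RSpace n)) t :=
    (hasDerivAt_id t).prodMk (hasDerivAt_const t x)
  have h3 := h1.comp_hasDerivAt t h2
  have e : (fun p : ℝ × RSpace n => g p.1 p.2) ∘ (fun s : ℝ => (s, x)) = fun s => g s x := rfl
  rw [e] at h3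
  exact h3.unique (hg.ode t x)

/-- Symmetry of the mixed second derivatives in time and space. -/
theorem hasDerivAt_mixed {E F : Type*} [NormedAddCommGroup E] [NormedSpace ℝ E]
    [NormedAddCommGroup F] [NormedSpace ℝ F] {G : ℝ × E → F} (hG : ContDiff ℝ ∞ G)
    (t : ℝ) (x v : E) :
    HasDerivAt (fun s => fderiv ℝ G (s, x) (0, v))
      (fderiv ℝ (fun y => fderiv ℝ G (t, y) (1, 0)) x v) t := by
  have hG1 : ContDiff ℝ ∞ (fderiv ℝ G) := hG.fderiv_right (by simp)
  have hd : HasFDerivAt (fderiv ℝ G) (fderiv ℝ (fderiv ℝ G) (t, x)) (t, x) :=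
    (hG1.differentiable (by simp) (t, x)).hasFDerivAt
  have h2 : HasDerivAt (fun s : ℝ => (s, x)) ((1 : ℝ), (0 : E)) t :=
    (hasDerivAt_id t).prodMk (hasDerivAt_const t x)
  have h3 : HasDerivAt (fun s : ℝ => fderiv ℝ G (s, x) (0, v))
      (fderiv ℝ (fderiv ℝ G) (t, x) (1, 0) (0, v)) t := by
    have h := hd.comp_hasDerivAt t h2
    have h' := hasDerivAt_apply_const h ((0 : ℝ), v)
    simp only [Function.comp_apply] at h'
    exact h'
  have hsymm : IsSymmSndFDerivAt ℝ G (t, x) :=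
    ContDiffAt.isSymmSndFDerivAt (n := 2)
      (hG.contDiffAt.of_le (WithTop.coe_le_coe.2 le_top)) (by simp)
  have h5 : HasFDerivAt (fun y : E => fderiv ℝ G (t, y))
      ((fderiv ℝ (fderiv ℝ G) (t, x)).comp (ContinuousLinearMap.inr ℝ ℝ E)) x :=
    hd.comp x (hasFDerivAt_prodMk_right t x)
  have h6 := hasFDerivAt_apply_const h5 ((1 : ℝ), (0 : E))
  rw [h6.fderiv]
  rw [hsymm.eq] at h3
  exact h3

/-- The variational equation along a generalised flow. -/
theorem IsGeneralisedFlow.variational (hg : IsGeneralisedFlow Y g) (t : ℝ) (x v : RSpace n) :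
    HasDerivAt (fun s => fderiv ℝ (g s) x v)
      (fderiv ℝ (Y t) (g t x) (fderiv ℝ (g t) x v)) t := by
  have h := hasDerivAt_mixed hg.smooth t x v
  have e : (fun y : RSpace n => fderiv ℝ (fun p : ℝ × RSpace n => g p.1 p.2) (t, y) (1, 0)) =
      (Y t) ∘ (g t) := by
    funext y; exact hg.fderiv_time t y
  have h4 : HasFDerivAt ((Y t) ∘ (g t))
      ((fderiv ℝ (Y t) (g t x)).comp (fderiv ℝ (g t) x)) x :=
    ((Y t).differentiable (g t x)).hasFDerivAt.comp x
      (((g t).contDiff.differentiable (by simp)) x).hasFDerivAt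
  rw [e, h4.fderiv] at h
  rw [funext fun s => hg.fderiv_apply s x v]
  exact h

theorem fderiv_fderiv_symm (f : Diffeo n) (x v : RSpace n) :
    fderiv ℝ f x (fderiv ℝ f.symm (f x) v) = v := by
  have h1 : HasFDerivAt f (fderiv ℝ f (f.symm (f x))) (f.symm (f x)) :=
    ((f.contDiff.differentiable (by simp)) _).hasFDerivAt
  have h2 : HasFDerivAt f.symm (fderiv ℝ f.symm (f x)) (f x) :=
    ((f.symm.contDiff.differentiable (by simp)) _).hasFDerivAt
  have h3 := h1.comp (f x) h2
  have e : (f ∘ f.symm : RSpace n → RSpace n) = id := by funext y; simp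
  rw [e] at h3
  have h4 := congrArg (fun A => A v) (h3.unique (hasFDerivAt_id (f x)))
  simpa using! h4

theorem push_symm_apply (f : Diffeo n) (X : VField n) (x : RSpace n) :
    push f.symm X x = fderiv ℝ f.symm (f x) (X (f x)) := rfl

theorem push_push_symm (f : Diffeo n) (X : VField n) : push f (push f.symm X) = X := by
  ext1 x
  have h : push f (push f.symm X) x =
    fderiv ℝ f (f.symm x) (fderiv ℝ f.symm (f (f.symm x)) (X (f (f.symm x)))) := rfl
  rw [h, fderiv_fderiv_symm]
  simp

/-- Derivative of the pull-back along a generalised flow: `d/dt g_t^* X = g_t^* [Y_t, X]`. -/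
theorem IsGeneralisedFlow.hasDerivAt_pull (hg : IsGeneralisedFlow Y g) (X : VField n)
    (t : ℝ) (x : RSpace n) :
    HasDerivAt (fun s => push (g s).symm X x) (push (g t).symm ⁅Y t, X⁆ x) t := by
  set G : ℝ × RSpace n → RSpace n := fun p => g p.1 p.2 with hG
  set K : ℝ × RSpace n → RSpace n := fun p => (g p.1).symm p.2 with hK
  have hcurve : ContDiff ℝ ∞ (fun s : ℝ => (s, x)) := contDiff_id.prodMk contDiff_const
  have hgx : ContDiff ℝ ∞ (fun s : ℝ => g s x) := hg.smooth.comp hcurve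
  -- differentiability of the pull-back
  have hKd : ∀ s y v, fderiv ℝ (g s).symm y v = fderiv ℝ K (s, y) (0, v) := by
    intro s y v
    have h1 : HasFDerivAt K (fderiv ℝ K (s, y)) (s, y) :=
      (hg.smooth_symm.differentiable (by simp) (s, y)).hasFDerivAt
    have h3 := h1.comp y (hasFDerivAt_prodMk_right s y)
    have h4 : K ∘ (fun y : RSpace n => (s, y)) = (g s).symm := rfl
    rw [h4] at h3
    rw [h3.fderiv]
    simp
  have hP : Differentiable ℝ (fun s => push (g s).symm X x) := by
    have e : (fun s => push (g s).symm X x) =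
        fun s => fderiv ℝ K (s, g s x) ((0 : ℝ), X (g s x)) := by
      funext s; rw [push_symm_apply, hKd]
    rw [e]
    have hK1 : ContDiff ℝ ∞ (fderiv ℝ K) := hg.smooth_symm.fderiv_right (by simp)
    have : ContDiff ℝ ∞ (fun s => fderiv ℝ K (s, g s x) ((0 : ℝ), X (g s x))) :=
      (hK1.comp (contDiff_id.prodMk hgx)).clm_apply
        (contDiff_const.prodMk (X.contDiff.comp hgx))
    exact this.differentiable (by simp)
  set P := fun s => push (g s).symm X x with hPdef
  -- the differential of the flow
  set M := fun s => fderiv ℝ (g s) x with hM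
  have hMd : DifferentiableAt ℝ M t := by
    have e : M = fun s => (fderiv ℝ G (s, x)).comp (ContinuousLinearMap.inr ℝ ℝ (RSpace n)) := by
      funext s
      ext1 v
      have := hg.fderiv_apply s x v
      simpa using! this
    rw [e]
    have hG1 : ContDiff ℝ ∞ (fderiv ℝ G) := hg.smooth.fderiv_right (by simp)
    have : ContDiff ℝ ∞
        (fun s => (fderiv ℝ G (s, x)).comp (ContinuousLinearMap.inr ℝ ℝ (RSpace n))) :=
      (hG1.comp hcurve).clm_comp contDiff_const
    exact this.differentiable (by simp) t
  have hM' : ∀ v, deriv M t v = fderiv ℝ (Y t) (g t x) (M t v) := by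
    intro v
    exact (hasDerivAt_apply_const hMd.hasDerivAt v).unique (hg.variational t x v)
  have hMP : ∀ s, M s (P s) = X (g s x) := fun s => fderiv_fderiv_symm (g s) x (X (g s x))
  have h1 : HasDerivAt (fun s => M s (P s)) (deriv M t (P t) + M t (deriv P t)) t :=
    hMd.hasDerivAt.clm_apply (hP t).hasDerivAt
  have h2 : HasDerivAt (fun s => X (g s x)) (fderiv ℝ X (g t x) (Y t (g t x))) t :=
    (X.differentiable (g t x)).hasFDerivAt.comp_hasDerivAt t (hg.ode t x)
  rw [funext hMP] at h1
  have h3 := h1.unique h2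
  rw [hM', hMP] at h3
  have h4 : M t (deriv P t) = ⁅Y t, X⁆ (g t x) := by
    rw [VField.bracket_apply, ← h3]; abel
  have h5 : deriv P t = push (g t).symm ⁅Y t, X⁆ x := by
    rw [push_symm_apply, ← h4]
    have := fderiv_fderiv_symm (g t).symm (g t x) (deriv P t)
    have e1 : (g t).symm (g t x) = x := (g t).symm_apply_apply x
    rw [e1] at this
    exact this.symm
  rw [← h5]
  exact (hP t).hasDerivAt

/-- Evaluation of the `i`-th component of a vector field at the point `x`. -/
def evalAt (x : RSpace n) (i : Fin n) : VField n →ₗ[ℝ] ℝ where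
  toFun X := X x i
  map_add' _ _ := rfl
  map_smul' _ _ := rfl

/-- On a finite-dimensional space of vector fields every linear functional is a linear
combination of evaluations of components at points. -/
theorem exists_eval_extension (U : Submodule ℝ (VField n)) [FiniteDimensional ℝ U]
    (l : U →ₗ[ℝ] ℝ) :
    ∃ m ∈ Submodule.span ℝ (Set.range fun p : RSpace n × Fin n => evalAt p.1 p.2),
      ∀ u : U, m u = l u := by
  have h : Submodule.span ℝ
      (Set.range fun p : RSpace n × Fin n => (evalAt p.1 p.2).comp U.subtype) = ⊤ := by
    apply Submodule.span_eq_top_of_ne_zero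
    intro z hz
    by_contra! hcon
    apply hz
    apply Subtype.ext
    ext1 x
    ext i
    exact hcon _ ⟨(x, i), rfl⟩
  have hl : l ∈ Submodule.span ℝ
      (Set.range fun p : RSpace n × Fin n => (evalAt p.1 p.2).comp U.subtype) := by
    rw [h]; trivial
  have e : (Set.range fun p : RSpace n × Fin n => (evalAt p.1 p.2).comp U.subtype) =
      (LinearMap.lcomp ℝ ℝ U.subtype) '' (Set.range fun p : RSpace n × Fin n =>
        evalAt p.1 p.2) := by
    rw [← Set.range_comp]; rfl
  rw [e, Submodule.span_image] at hl
  obtain ⟨m, hm, hml⟩ := hl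
  exact ⟨m, hm, fun u => by rw [← hml]; rfl⟩

end Aux

namespace Scheme

variable {n : ℕ} (S : Scheme n)

theorem finite_W : FiniteDimensional ℝ S.W :=
  Submodule.finiteDimensional_of_le S.le

/-- Pull-backs by elements of `𝒢_W` map `V` to `V`. -/
theorem pull_mem {Y : S.Family} (hY : ∀ t, Y.field t ∈ S.W) {g : ℝ → Diffeo n}
    (hg : IsGeneralisedFlow Y.field g) (t : ℝ) (v : S.V) : push (g t).symm v ∈ S.V := by
  classical
  by_contra hmem
  obtain ⟨l0, hl0, hker⟩ := Submodule.exists_le_ker_of_notMem hmem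
  let U : Submodule ℝ (VField n) := S.V ⊔ Submodule.span ℝ {push (g t).symm (v : VField n)}
  obtain ⟨l, hl, hlU⟩ := exists_eval_extension U (l0.comp U.subtype)
  have hlV : ∀ u : S.V, l u = 0 := fun u => by
    have h1 := hlU ⟨u, (le_sup_left : S.V ≤ U) u.2⟩
    have h2 : l0 u = 0 := hker u.2
    simpa [h2] using h1
  have hlf : l (push (g t).symm v) ≠ 0 := by
    have h1 := hlU ⟨_, (le_sup_right : _ ≤ U) (Submodule.mem_span_singleton_self _)⟩
    have h2 : l (push (g t).symm v) = l0 (push (g t).symm v) := by simpa using h1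
    rw [h2]; exact hl0
  -- derivatives of the test functional along pull-backs
  have hder : ∀ (X : VField n) (s : ℝ), HasDerivAt (fun s => l (push (g s).symm X))
      (l (push (g s).symm ⁅Y.field s, X⁆)) s := by
    intro X s
    clear hlU hlV hlf
    induction hl using Submodule.span_induction with
    | mem m hm =>
      obtain ⟨p, rfl⟩ := hm
      have h := hg.hasDerivAt_pull X s p.1
      have h2 := (EuclideanSpace.proj p.2 : RSpace n →L[ℝ] ℝ).hasFDerivAt.comp_hasDerivAt s h
      exact h2
    | zero => simpa using hasDerivAt_const s (0 : ℝ)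
    | add m m' _ _ h h' => exact h.add h'
    | smul c m _ h => exact h.const_mul c
  let b := Module.finBasis ℝ S.V
  let r := Module.finrank ℝ S.V
  obtain ⟨π, hπ⟩ := (S.W.comap S.V.subtype).exists_isCompl
  -- the coefficients of the bracket with `Y_s`, as a linear map in `Y_s`
  let pr : S.V →ₗ[ℝ] (S.W.comap S.V.subtype) := Submodule.projectionOnto _ _ hπ
  let A : Fin r → S.V →ₗ[ℝ] S.V := fun j =>
    { toFun := fun y => ⟨⁅((pr y : S.V) : VField n), (b j : VField n)⁆,
        S.bracket_WV _ (pr y).2 _ (b j).2⟩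
      map_add' := fun y z => by
        apply Subtype.ext
        simp [VField.add_bracket]
      map_smul' := fun c y => by
        apply Subtype.ext
        simp [VField.smul_bracket] }
  have hA : ∀ j s, ((A j (Y s) : S.V) : VField n) = ⁅Y.field s, (b j : VField n)⁆ := by
    intro j s
    have h1 : pr (Y s) = ⟨Y s, hY s⟩ :=
      Submodule.projectionOnto_apply_left hπ ⟨Y s, hY s⟩
    change ⁅((pr (Y s) : S.V) : VField n), (b j : VField n)⁆ = _
    rw [h1]
  let a : ℝ → Fin r → Fin r → ℝ := fun s j k => b.repr (A j (Y s)) k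
  have hYc : Continuous (fun s => Y s) := Y.contMDiff.continuous
  have ha : Continuous a := by
    refine continuous_pi fun j => continuous_pi fun k => ?_
    exact ((b.coord k).comp (A j)).continuous_of_finiteDimensional.comp hYc
  let u : ℝ → Fin r → ℝ := fun s j => l (push (g s).symm (b j : VField n))
  let B : ℝ → (Fin r → ℝ) → (Fin r → ℝ) := fun s w j => ∑ k, a s j k * w k
  have hpushsum : ∀ (s : ℝ) (c : S.V), l (push (g s).symm (c : VField n)) =
      ∑ k, b.repr c k * u s k := by
    intro s c
    let ψ : S.V →ₗ[ℝ] ℝ :=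
      { toFun := fun c => l (push (g s).symm (c : VField n))
        map_add' := fun c d => by
          rw [← map_add]; congr 1; ext1 x
          simp [push_symm_apply]
        map_smul' := fun c d => by
          rw [RingHom.id_apply, ← map_smul]; congr 1; ext1 x
          simp [push_symm_apply] }
    change ψ c = _
    conv_lhs => rw [← b.sum_repr c]
    rw [map_sum]
    refine Finset.sum_congr rfl fun k _ => ?_
    rw [map_smul]; rfl
  have hu : ∀ s, HasDerivAt u (B s (u s)) s := by
    intro s
    rw [hasDerivAt_pi]
    intro j
    have h1 := hder (b j : VField n) s
    have h2 : l (push (g s).symm ⁅Y.field s, (b j : VField n)⁆) = B s (u s) j := by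
      rw [← hA, hpushsum]
    rw [h2] at h1
    exact h1
  have hu0 : u 0 = 0 := by
    funext j
    have h1 : push (g 0).symm (b j : VField n) = b j := by
      have hg0 : (g 0 : RSpace n → RSpace n) = id := funext hg.zero
      have hg0' : ((g 0).symm : RSpace n → RSpace n) = id := by
        funext x
        have h2 := (g 0).apply_symm_apply x
        rw [hg.zero] at h2
        exact h2
      ext1 x
      rw [push_symm_apply, hg0', hg0]
      simp
    change l (push (g 0).symm (b j : VField n)) = 0
    rw [h1]; exact hlV _
  -- uniqueness for linear differential equations
  have huz : u t = 0 := by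
    obtain ⟨C, hC⟩ := (isCompact_Icc (a := -(|t| + 1)) (b := |t| + 1)).exists_bound_of_continuousOn
      ha.continuousOn
    have hlip : ∀ s ∈ Set.Ioo (-(|t| + 1)) (|t| + 1),
        LipschitzOnWith (Real.toNNReal (r * C)) (B s) Set.univ := by
      intro s hs
      apply LipschitzWith.lipschitzOnWith
      apply LipschitzWith.of_dist_le_mul
      intro w w'
      have hC' := hC s ⟨hs.1.le, hs.2.le⟩
      have hC0 : 0 ≤ C := (norm_nonneg _).trans hC'
      rw [Real.coe_toNNReal _ (by positivity), dist_pi_le_iff (by positivity)]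
      intro j
      rw [Real.dist_eq]
      change |∑ k, a s j k * w k - ∑ k, a s j k * w' k| ≤ _
      rw [← Finset.sum_sub_distrib]
      calc |∑ k, (a s j k * w k - a s j k * w' k)|
          ≤ ∑ k, |a s j k * w k - a s j k * w' k| := Finset.abs_sum_le_sum_abs _ _
        _ ≤ ∑ _k : Fin r, C * dist w w' := by
            refine Finset.sum_le_sum fun k _ => ?_
            rw [← mul_sub, abs_mul]
            have h1 : |a s j k| ≤ C :=
              ((norm_le_pi_norm (a s j) k).trans (norm_le_pi_norm (a s) j)).trans hC'
            have h2 : |w k - w' k| ≤ dist w w' := by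
              rw [← Real.dist_eq]; exact dist_le_pi_dist w w' k
            gcongr
        _ = r * C * dist w w' := by simp [mul_assoc]
    have habs : -(|t| + 1) < t ∧ t < |t| + 1 :=
      ⟨by have := neg_abs_le t; linarith, by have := le_abs_self t; linarith⟩
    have hz := ODE_solution_unique_of_mem_Ioo (v := B) (s := fun _ => Set.univ) (f := u)
      (g := fun _ => (0 : Fin r → ℝ)) hlip (t₀ := 0)
      ⟨by have := abs_nonneg t; linarith, by have := abs_nonneg t; linarith⟩
      (fun s _ => ⟨hu s, trivial⟩)
      (fun s _ => ⟨by
        have : B s 0 = 0 := by funext j; simp [B]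
        rw [this]; exact hasDerivAt_const s _, trivial⟩) hu0
    exact hz habs
  apply hlf
  rw [hpushsum]
  simp [huz]

/-- Push-forwards by elements of `𝒢_W` map `V` to `V`. -/
theorem push_mem {Y : S.Family} (hY : ∀ t, Y.field t ∈ S.W) {g : ℝ → Diffeo n}
    (hg : IsGeneralisedFlow Y.field g) (t : ℝ) (v : S.V) : push (g t) v ∈ S.V := by
  let ψ : S.V →ₗ[ℝ] S.V :=
    { toFun := fun c => ⟨push (g t).symm c, S.pull_mem hY hg t c⟩
      map_add' := fun c d => by
        apply Subtype.ext; ext1 x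
        simp [push_symm_apply]
      map_smul' := fun c d => by
        apply Subtype.ext; ext1 x
        simp [push_symm_apply] }
  have hinj : Function.Injective ψ := by
    intro c d hcd
    have h1 : push (g t).symm (c : VField n) = push (g t).symm (d : VField n) :=
      congrArg Subtype.val hcd
    have h2 := congrArg (push (g t)) h1
    rw [push_push_symm, push_push_symm] at h2
    exact Subtype.ext h2
  obtain ⟨w, hw⟩ := LinearMap.injective_iff_surjective.mp hinj v
  have h1 : push (g t).symm (w : VField n) = v := congrArg Subtype.val hw
  rw [← h1, push_push_symm]
  exact w.2

/-- A curve in `V` is smooth if it is smooth as a `t`-dependent vector field. -/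
theorem contDiff_of_eval {c : ℝ → S.V}
    (h : ∀ x, ContDiff ℝ ∞ (fun t => (c t : VField n) x)) : ContDiff ℝ ∞ c := by
  have h1 : ∀ m ∈ Submodule.span ℝ (Set.range fun p : RSpace n × Fin n => evalAt p.1 p.2),
      ContDiff ℝ ∞ (fun t => m (c t : VField n)) := by
    intro m hm
    induction hm using Submodule.span_induction with
    | mem m hm =>
      obtain ⟨p, rfl⟩ := hm
      exact (EuclideanSpace.proj p.2 : RSpace n →L[ℝ] ℝ).contDiff.comp (h p.1)
    | zero => simpa using contDiff_const
    | add m m' _ _ h h' => exact h.add h'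
    | smul a m _ h => exact contDiff_const.mul h
  let b := Module.finBasis ℝ S.V
  have h2 : ContDiff ℝ ∞ (fun t => b.equivFun.toContinuousLinearEquiv (c t)) := by
    rw [contDiff_pi]
    intro k
    obtain ⟨m, hm, hml⟩ := exists_eval_extension S.V (b.coord k)
    have h3 := h1 m hm
    have e : (fun t => b.equivFun.toContinuousLinearEquiv (c t) k) =
        fun t => m (c t : VField n) := by
      funext t; rw [hml]; rfl
    rw [e]; exact h3
  have h3 := b.equivFun.toContinuousLinearEquiv.symm.contDiff.comp h2 (n := ∞)
  have e : (b.equivFun.toContinuousLinearEquiv.symm ∘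
      fun t => b.equivFun.toContinuousLinearEquiv (c t)) = c := by
    funext t; simp
  rw [e] at h3
  exact h3

/-- `(g_★ X)_t = Y_t + g_{t*} X_t`, where `Y_t = ∂g_t/∂t ∘ g_t⁻¹`. -/
theorem starFun_eq {Y : ℝ → VField n} {g : ℝ → Diffeo n} (hg : IsGeneralisedFlow Y g)
    (X : ℝ → VField n) (t : ℝ) (x : RSpace n) :
    starFun g X t x = Y t x + push (g t) (X t) x := by
  set y := (g t).symm x with hy
  have h1 : HasFDerivAt (fun p : ℝ × RSpace n => g p.1 p.2)
      (fderiv ℝ (fun p : ℝ × RSpace n => g p.1 p.2) (t, y)) (t, y) :=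
    (hg.smooth.differentiable (by simp) (t, y)).hasFDerivAt
  have h2 : HasFDerivAt (autonomisation g)
      ((ContinuousLinearMap.fst ℝ ℝ (RSpace n)).prod
        (fderiv ℝ (fun p : ℝ × RSpace n => g p.1 p.2) (t, y))) (t, y) :=
    hasFDerivAt_fst.prodMk h1
  have h3 : starFun g X t x =
      fderiv ℝ (fun p : ℝ × RSpace n => g p.1 p.2) (t, y) (1, X t y) := by
    unfold starFun
    rw [← hy, h2.fderiv]
    rfl
  have h4 : ((1 : ℝ), X t y) = (1, 0) + (0, X t y) := by simp
  rw [h3, h4, map_add, hg.fderiv_time, ← hg.fderiv_apply]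
  have h5 : g t y = x := (g t).apply_symm_apply x
  rw [h5]; rfl

theorem Family.contDiff {S : Scheme n} (X : S.Family) : ContDiff ℝ ∞ (fun t => X t) :=
  X.contMDiff.contDiff

/-- `𝒱` is stable under the action of `𝒢_W`. -/
theorem exists_star {g : ℝ → Diffeo n} (hg : g ∈ S.groupW) (X : S.Family) :
    ∃ X' : S.Family, ∀ t x, X'.field t x = starFun g X.field t x := by
  obtain ⟨Y, hY, hflow⟩ := hg
  let c : ℝ → S.V := fun t => Y t + ⟨push (g t) (X.field t), S.push_mem hY hflow t (X t)⟩
  have hc : ∀ t x, (c t : VField n) x = starFun g X.field t x := fun t x => by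
    rw [starFun_eq hflow]; rfl
  have hev : ∀ x, ContDiff ℝ ∞ (fun t => (c t : VField n) x) := by
    intro x
    -- a linear functional of a smooth curve in `V` is smooth
    have hZ : ∀ Z : S.Family, ContDiff ℝ ∞ (fun p : ℝ × RSpace n => Z.field p.1 p.2) := by
      intro Z
      let b := Module.finBasis ℝ S.V
      have e : (fun p : ℝ × RSpace n => Z.field p.1 p.2) =
          fun p => ∑ k, b.coord k (Z p.1) • (b k : VField n) p.2 := by
        funext p
        have h1 := congrArg (fun v : S.V => (v : VField n) p.2) (b.sum_repr (Z p.1))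
        let ev : S.V →ₗ[ℝ] RSpace n :=
          { toFun := fun v => (v : VField n) p.2
            map_add' := fun _ _ => rfl
            map_smul' := fun _ _ => rfl }
        change ev (Z p.1) = _
        conv_lhs => rw [← b.sum_repr (Z p.1)]
        rw [map_sum]
        refine Finset.sum_congr rfl fun k _ => ?_
        rw [map_smul]; rfl
      rw [e]
      refine ContDiff.sum fun k _ => ?_
      have h1 : ContDiff ℝ ∞ (fun t => b.coord k (Z t)) :=
        (b.coord k).toContinuousLinearMap.contDiff.comp Z.contDiff
      exact (h1.comp contDiff_fst).smul ((b k : VField n).contDiff.comp contDiff_snd)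
    have hxc : ContDiff ℝ ∞ (fun s : ℝ => (s, x)) := contDiff_id.prodMk contDiff_const
    have hsy : ContDiff ℝ ∞ (fun s : ℝ => (g s).symm x) := hflow.smooth_symm.comp hxc
    have e : (fun t => (c t : VField n) x) = fun t => Y.field t x +
        fderiv ℝ (fun p : ℝ × RSpace n => g p.1 p.2) (t, (g t).symm x)
          ((0 : ℝ), X.field t ((g t).symm x)) := by
      funext t
      rw [← hflow.fderiv_apply]; rfl
    rw [e]
    have hG1 : ContDiff ℝ ∞ (fderiv ℝ (fun p : ℝ × RSpace n => g p.1 p.2)) :=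
      hflow.smooth.fderiv_right (by simp)
    have hY1 : ContDiff ℝ ∞ (fun t => Y.field t x) := (hZ Y).comp hxc
    have hX1 : ContDiff ℝ ∞ (fun t => X.field t ((g t).symm x)) :=
      (hZ X).comp (contDiff_id.prodMk hsy)
    exact hY1.add ((hG1.comp (contDiff_id.prodMk hsy)).clm_apply (contDiff_const.prodMk hX1))
  exact ⟨⟨c, (S.contDiff_of_eval hev).contMDiff⟩, hc⟩

/-- Push-forwards by the flow of `L ∈ W` map `V` to `V`. -/
theorem push_flow_mem {L : VField n} (hL : L ∈ S.W) {h : ℝ → Diffeo n} (hh : IsFlow L h)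
    (s : ℝ) (v : S.V) : push (h s) v ∈ S.V :=
  S.push_mem (Y := ⟨fun _ => ⟨L, S.le hL⟩, contMDiff_const⟩) (fun _ => hL) hh s v

end Scheme

/-! ### Quasi-Lie invariants of order two -/

namespace Scheme

variable {n : ℕ} (S : Scheme n)

/-- The action `X ↦ g_★ X` of `𝒢_W` on the quasi-Lie family `𝒱`. -/
noncomputable def star {g : ℝ → Diffeo n} (hg : g ∈ S.groupW) (X : S.Family) : S.Family :=
  (S.exists_star hg X).choose

theorem star_field {g : ℝ → Diffeo n} (hg : g ∈ S.groupW) (X : S.Family) (t : ℝ)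
    (x : RSpace n) : (S.star hg X).field t x = starFun g X.field t x :=
  (S.exists_star hg X).choose_spec t x

/-- `F : 𝒱 → C^∞(ℝ)` is a quasi-Lie invariant: `F(g_★ X) = F(X)` for all `g ∈ 𝒢_W`, `X ∈ 𝒱`. -/
def IsQuasiLieInvariant (F : S.Family → C^∞⟮𝓘(ℝ, ℝ), ℝ; ℝ⟯) : Prop :=
  ∀ (g : ℝ → Diffeo n) (hg : g ∈ S.groupW) (X : S.Family), F (S.star hg X) = F X

/-- The second-order tangent bundle `T²V`, identified with `V³` by means of the coordinates
`(X, dX/dt̄, d²X/dt̄²)` of second-order tangent vectors. -/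
abbrev T2V : Type := S.V × S.V × S.V

/-- The coordinates `(X, dX/dt̄, d²X/dt̄²)` at `t₀` of the second-order tangent vector `𝐭²_{t₀} X`
of the curve `X` in `V`, for the parameter `t̄` given by `t = t₀ + τ(t̄)`. -/
noncomputable def jet (τ : ℝ → ℝ) (X : S.Family) (t₀ : ℝ) : S.T2V :=
  (X t₀, deriv (fun u => X (t₀ + τ u)) 0, iteratedDeriv 2 (fun u => X (t₀ + τ u)) 0)

/-- `F` is a quasi-Lie invariant of order two for `S(W, V)`: it is a quasi-Lie invariant and
`F(X)(t) = φ(𝐭²_t X)` for some smooth `φ : T²V → ℝ`. -/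
def IsQuasiLieInvariantOfOrderTwo (F : S.Family → C^∞⟮𝓘(ℝ, ℝ), ℝ; ℝ⟯) : Prop :=
  S.IsQuasiLieInvariant F ∧
    ∃ φ : S.T2V → ℝ, ContDiff ℝ ∞ φ ∧ ∀ (X : S.Family) (t : ℝ), F X t = φ (S.jet id X t)

/-! ### The actions and flows on `T²V` -/

/-- The bracket `[L, v] ∈ V` of `L ∈ W` and `v ∈ V`. -/
noncomputable def br (L : S.W) (v : S.V) : S.V :=
  ⟨⁅(L : VField n), (v : VField n)⁆, S.bracket_WV L L.2 v v.2⟩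

/-- The inclusion `W ⊆ V`. -/
def incl (L : S.W) : S.V := ⟨L, S.le L.2⟩

/-- The action `𝒥²` of a diffeomorphism preserving `V`:
`(X₀, X₁, X₂) ↦ (f_* X₀, f_* X₁, f_* X₂)`. -/
noncomputable def actJ (f : Diffeo n) (hf : ∀ v : S.V, push f v ∈ S.V) (p : S.T2V) : S.T2V :=
  (⟨push f p.1, hf p.1⟩, ⟨push f p.2.1, hf p.2.1⟩, ⟨push f p.2.2, hf p.2.2⟩)

/-- The action `𝒥²` along the one-parameter group `h_s = exp(sL)`, where `L ∈ W`. -/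
noncomputable def flowJ (L : S.W) {h : ℝ → Diffeo n} (hh : IsFlow (L : VField n) h) (s : ℝ) :
    S.T2V → S.T2V :=
  S.actJ (h s) (S.push_flow_mem L.2 hh s)

/-- The action `𝒯²` of the element `(0, 0, Y)` of `T²₁W`. -/
noncomputable def actT (Y : S.W) (p : S.T2V) : S.T2V :=
  (p.1, p.2.1, p.2.2 + S.incl Y)

/-- The map `𝒯₁^L(s, ·)`, where `a = dt/dt̄` and `b = d²t/dt̄²`. -/
noncomputable def flowT1 (a b : ℝ) (L : S.W) (s : ℝ) (p : S.T2V) : S.T2V :=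
  p + (s • S.incl L,
    -(s * a) • S.br L p.1,
    (s ^ 2 * a ^ 2) • S.br L (S.br L p.1) - (2 * s * a) • S.br L p.2.1 - (b * s) • S.br L p.1)

/-- The action `𝒯₂` of the element `(0, Y₁, Y₂)` of `T²₀W`, where `a = dt/dt̄`. -/
noncomputable def actT2 (a : ℝ) (Y₁ Y₂ : S.W) (p : S.T2V) : S.T2V :=
  (p.1, S.incl Y₁ + p.2.1, -a • S.br Y₁ p.1 + p.2.2 + S.incl Y₂)

/-- The vector field on `T²V` associated with a flow `A : ℝ × T²V → T²V`. For the restriction of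
a Lie group action to a one-parameter subgroup it is a fundamental vector field. -/
noncomputable def generator (A : ℝ → S.T2V → S.T2V) (p : S.T2V) : S.T2V :=
  deriv (fun s => A s p) 0

/-- The smooth function `φ` is a first integral of the vector field `ξ` on `T²V`. -/
def IsFirstIntegral (φ : S.T2V → ℝ) (ξ : S.T2V → S.T2V) : Prop :=
  ∀ p, fderiv ℝ φ p (ξ p) = 0

/-- `φ` is a first integral of the fundamental vector fields of `𝒥²`. -/
def IsFirstIntegralJ (φ : S.T2V → ℝ) : Prop :=
  ∀ (L : S.W) (h : ℝ → Diffeo n) (hh : IsFlow (L : VField n) h),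
    S.IsFirstIntegral φ (S.generator (S.flowJ L hh))

/-- `φ` is a first integral of the fundamental vector fields of `𝒯²`. -/
def IsFirstIntegralT (φ : S.T2V → ℝ) : Prop :=
  ∀ Y : S.W, S.IsFirstIntegral φ (S.generator fun s => S.actT (s • Y))

/-- `φ` is a first integral of the vector fields with flows `𝒯₁^L`, `L ∈ W`. -/
def IsFirstIntegralT1 (a b : ℝ) (φ : S.T2V → ℝ) : Prop :=
  ∀ L : S.W, S.IsFirstIntegral φ (S.generator (S.flowT1 a b L))

/-- `φ` is a first integral of the fundamental vector fields of `𝒯₂`. -/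
def IsFirstIntegralT2 (a : ℝ) (φ : S.T2V → ℝ) : Prop :=
  ∀ Y₁ Y₂ : S.W, S.IsFirstIntegral φ (S.generator fun s => S.actT2 a (s • Y₁) (s • Y₂))

end Scheme

end QuasiLie

/-! ### Linearity of the bracket and elementary facts about flows. -/

namespace QuasiLie

/-! If `g` is the generalised flow of `Y`, then `g_★ X = Y + g_* X`, and a curve of push-forwards
obeys `d/dt (g_* X) = -[Y, g_* X] + g_* X'` (`hasDerivAt_pushFamily`). Differentiating twice, the
second-order jet of `g_★ X` at `t` depends only on the jet of `X`, on `g_t`, and on `Y`, `Y'`, `Y''`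
at `t`. In the coordinates of `T²V` this dependence is a composite: the push-forward by `g_t`, then
`𝒯₁` at time one for `Y_t`, then an element of `𝒯₂` (`jet_star`). The parameter change `τ` enters
only through `a` and `b`.

First integrals give invariants: `φ` is constant along any curve whose velocity it annihilates. This
applies to the orbits of `𝒯₂` and `𝒯₁^L`. It also applies to `t ↦ g_{t*} p`, although `g` is driven
by a time-dependent field: its velocity at each instant is the fundamental vector field of `𝒥²` for
the current `Y_t`, which exists because `Y_t` is complete. Hence `φ` is unchanged by all three
factors.

Invariants give first integrals: for a complete `L ∈ W`, reparametrise its flow by a polynomial `σ`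
with `σ(0) = 0`. The Taylor coefficients of `σ` at `t = 1` up to order three are arbitrary, and
every point of `T²V` is a jet at `1`, so `φ` is invariant under the three factors with independent
coefficients (`apply_actT2_flowT1_flowJ`). Switching off all but one factor and differentiating
gives the first integrals. The field of `𝒯²` is the case `Y' = 0` of `𝒯₂`, and linearity of
generators handles distinct `Y'` and `Y''`. -/

theorem VField.bracket_add {n : ℕ} (X Y Z : VField n) : ⁅X, Y + Z⁆ = ⁅X, Y⁆ + ⁅X, Z⁆ := by
  ext1 x
  exact VectorField.lieBracket_add_right (Y.differentiable x) (Z.differentiable x)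

theorem VField.bracket_smul {n : ℕ} (c : ℝ) (X Y : VField n) : ⁅X, c • Y⁆ = c • ⁅X, Y⁆ := by
  ext1 x
  exact VectorField.lieBracket_const_smul_right (Y.differentiable x)

/-- The differential of a generalised flow at a fixed point depends differentiably on time. -/
theorem IsGeneralisedFlow.differentiable_fderiv {n : ℕ} {Y : ℝ → VField n} {g : ℝ → Diffeo n}
    (hg : IsGeneralisedFlow Y g) (x : RSpace n) :
    Differentiable ℝ (fun s => fderiv ℝ (g s) x) := by
  have e : (fun s => fderiv ℝ (g s) x) =
      fun s => (fderiv ℝ (fun p : ℝ × RSpace n => g p.1 p.2) (s, x)).comp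
        (ContinuousLinearMap.inr ℝ ℝ (RSpace n)) := by
    funext s
    ext1 v
    have := hg.fderiv_apply s x v
    simpa using! this
  rw [e]
  have hG1 : ContDiff ℝ ∞ (fderiv ℝ (fun p : ℝ × RSpace n => g p.1 p.2)) :=
    hg.smooth.fderiv_right (by simp)
  have : ContDiff ℝ ∞ (fun s => (fderiv ℝ (fun p : ℝ × RSpace n => g p.1 p.2) (s, x)).comp
      (ContinuousLinearMap.inr ℝ ℝ (RSpace n))) :=
    (hG1.comp (contDiff_id.prodMk contDiff_const)).clm_comp contDiff_const
  exact this.differentiable (by simp)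

theorem push_apply_self {n : ℕ} (f : Diffeo n) (X : VField n) (x : RSpace n) :
    push f X (f x) = fderiv ℝ f x (X x) := by
  change fderiv ℝ f (f.symm (f x)) (X (f.symm (f x))) = _
  rw [f.symm_apply_apply]

theorem IsGeneralisedFlow.push_zero {n : ℕ} {Y : ℝ → VField n} {g : ℝ → Diffeo n}
    (hg : IsGeneralisedFlow Y g) (X : VField n) : push (g 0) X = X := by
  ext1 x
  have h := push_apply_self (g 0) X x
  have e : (g 0 : RSpace n → RSpace n) = id := funext hg.zero
  rw [hg.zero] at h
  rw [h, e]
  simp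

/-- Reparametrisation of the flow of `L` by `σ` is a generalised flow of `σ' L`. -/
theorem IsGeneralisedFlow.reparam {n : ℕ} {L : VField n} {h : ℝ → Diffeo n} (hh : IsFlow L h)
    {σ σ' : ℝ → ℝ} (hσ : ContDiff ℝ ∞ σ) (hσ0 : σ 0 = 0) (hσ' : ∀ t, HasDerivAt σ (σ' t) t) :
    IsGeneralisedFlow (fun t => σ' t • L) (fun t => h (σ t)) where
  smooth := hh.smooth.comp ((hσ.comp contDiff_fst).prodMk contDiff_snd)
  smooth_symm := hh.smooth_symm.comp ((hσ.comp contDiff_fst).prodMk contDiff_snd)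
  zero x := by rw [hσ0]; exact hh.zero x
  ode t x := (hh.ode (σ t) x).scomp t (hσ' t)

namespace Scheme

variable {n : ℕ} {S : Scheme n}

/-! ### Calculus of smooth curves in `V`. -/

namespace Family

/-- A smooth curve in `V` is jointly smooth in time and space. -/
theorem contDiff_uncurry (Z : S.Family) :
    ContDiff ℝ ∞ (fun p : ℝ × RSpace n => Z.field p.1 p.2) := by
  -- In a basis of `V` the field is a finite sum of smooth coefficients in time multiplying fixed
  -- smooth fields in space.
  let b := Module.finBasis ℝ S.V
  have e : (fun p : ℝ × RSpace n => Z.field p.1 p.2) =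
      fun p => ∑ k, b.coord k (Z p.1) • (b k : VField n) p.2 := by
    funext p
    let ev : S.V →ₗ[ℝ] RSpace n :=
      { toFun := fun v => (v : VField n) p.2
        map_add' := fun _ _ => rfl
        map_smul' := fun _ _ => rfl }
    change ev (Z p.1) = _
    conv_lhs => rw [← b.sum_repr (Z p.1)]
    rw [map_sum]
    refine Finset.sum_congr rfl fun k _ => ?_
    rw [map_smul]; rfl
  rw [e]
  refine ContDiff.sum fun k _ => ?_
  have h1 : ContDiff ℝ ∞ (fun t => b.coord k (Z t)) :=
    (b.coord k).toContinuousLinearMap.contDiff.comp Z.contDiff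
  exact (h1.comp contDiff_fst).smul ((b k : VField n).contDiff.comp contDiff_snd)

/-- The derivative of a smooth curve in `V`. -/
noncomputable def deriv (X : S.Family) : S.Family :=
  ⟨_root_.deriv X, ((contDiff_infty_iff_deriv.1 X.contDiff).2).contMDiff⟩

theorem hasDerivAt (X : S.Family) (t : ℝ) : HasDerivAt X (X.deriv t) t :=
  (X.contDiff.differentiable (by simp) t).hasDerivAt

theorem hasDerivAt_eval (X : S.Family) (t : ℝ) (x : RSpace n) :
    HasDerivAt (fun s => X.field s x) (X.deriv.field t x) t := by
  let ev : S.V →ₗ[ℝ] RSpace n :=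
    { toFun := fun v => (v : VField n) x
      map_add' := fun _ _ => rfl
      map_smul' := fun _ _ => rfl }
  exact ev.toContinuousLinearMap.hasFDerivAt.comp_hasDerivAt t (X.hasDerivAt t)

/-- Joint smoothness allows the total derivative to be split into its time and space parts. This is
what lets a moving field be differentiated along a trajectory. -/
theorem hasDerivAt_along (X : S.Family) {γ : ℝ → RSpace n} {γ' : RSpace n} {t : ℝ}
    (hγ : HasDerivAt γ γ' t) :
    HasDerivAt (fun s => X.field s (γ s))
      (X.deriv.field t (γ t) + fderiv ℝ (X.field t) (γ t) γ') t := by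
  have h1 : HasFDerivAt (fun p : ℝ × RSpace n => X.field p.1 p.2)
      (fderiv ℝ (fun p : ℝ × RSpace n => X.field p.1 p.2) (t, γ t)) (t, γ t) :=
    (X.contDiff_uncurry.differentiable (by simp) _).hasFDerivAt
  have h2 := h1.comp_hasDerivAt t ((hasDerivAt_id t).prodMk hγ)
  have h3 : HasDerivAt ((fun p : ℝ × RSpace n => X.field p.1 p.2) ∘ fun s => (s, γ t))
      (fderiv ℝ (fun p : ℝ × RSpace n => X.field p.1 p.2) (t, γ t) (1, 0)) t :=
    h1.comp_hasDerivAt t ((hasDerivAt_id t).prodMk (hasDerivAt_const t (γ t)))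
  have h3' := h3.unique (X.hasDerivAt_eval t (γ t))
  have h4 := (h1.comp (γ t) (hasFDerivAt_prodMk_right t (γ t))).fderiv
  have h5 : fderiv ℝ (X.field t) (γ t) γ' =
      fderiv ℝ (fun p : ℝ × RSpace n => X.field p.1 p.2) (t, γ t) (0, γ') := by
    change fderiv ℝ ((fun p : ℝ × RSpace n => X.field p.1 p.2) ∘ fun y => (t, y)) (γ t) γ' = _
    rw [h4]; simp
  rw [h5, ← h3', ← map_add, Prod.mk_add_mk, add_zero, zero_add]
  exact h2

/-- The derivative of a curve in `W` is a curve in `W`. -/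
theorem deriv_mem (Y : S.Family) (hY : ∀ t, Y.field t ∈ S.W) (t : ℝ) : Y.deriv.field t ∈ S.W := by
  obtain ⟨π, hπ⟩ := (S.W.comap S.V.subtype).exists_isCompl
  -- A linear projection onto `W` fixes the curve `Y`, and it commutes with differentiation, so it
  -- also fixes `Y'`.
  let pr : S.V →ₗ[ℝ] S.V := Submodule.projection _ _ hπ
  have hpr : ∀ v, pr v ∈ S.W.comap S.V.subtype := fun v => by
    change ((Submodule.projectionOnto _ _ hπ v : S.W.comap S.V.subtype) : S.V) ∈ _
    exact Subtype.coe_prop _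
  have h1 : HasDerivAt (fun s => pr (Y s)) (pr (Y.deriv t)) t :=
    pr.toContinuousLinearMap.hasFDerivAt.comp_hasDerivAt t (Y.hasDerivAt t)
  have h2 : (fun s => pr (Y s)) = Y := by
    funext s
    exact congrArg Subtype.val (Submodule.projectionOnto_apply_left hπ ⟨Y s, hY s⟩)
  rw [h2] at h1
  have h3 := h1.unique (Y.hasDerivAt t)
  have := hpr (Y.deriv t)
  rw [h3] at this
  exact this

end Family

/-! ### The bracket `W × V → V`. -/

variable (S)

theorem br_add (L : S.W) (u v : S.V) : S.br L (u + v) = S.br L u + S.br L v :=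
  Subtype.ext (VField.bracket_add _ _ _)

theorem br_smul (L : S.W) (c : ℝ) (v : S.V) : S.br L (c • v) = c • S.br L v :=
  Subtype.ext (VField.bracket_smul _ _ _)

theorem add_br (K L : S.W) (v : S.V) : S.br (K + L) v = S.br K v + S.br L v :=
  Subtype.ext (VField.add_bracket _ _ _)

theorem smul_br (c : ℝ) (L : S.W) (v : S.V) : S.br (c • L) v = c • S.br L v :=
  Subtype.ext (VField.smul_bracket _ _ _)

theorem br_self (L : S.W) : S.br L (S.incl L) = 0 := by
  apply Subtype.ext
  ext1 x
  exact sub_self _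

/-- The bracket `W × V → V` extends to a continuous bilinear map on `V`. -/
theorem exists_bracket_extension :
    ∃ B : S.V →L[ℝ] S.V →L[ℝ] S.V, ∀ (L : S.W) (v : S.V), B (S.incl L) v = S.br L v := by
  -- Precomposing the first argument with a projection of `V` onto `W` extends the bracket;
  -- continuity is automatic in finite dimension.
  obtain ⟨π, hπ⟩ := (S.W.comap S.V.subtype).exists_isCompl
  let pr : S.V →ₗ[ℝ] (S.W.comap S.V.subtype) := Submodule.projectionOnto _ _ hπ
  let prW : S.V →ₗ[ℝ] S.W :=
    { toFun := fun y => ⟨((pr y : S.V) : VField n), (pr y).2⟩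
      map_add' := fun y z => by apply Subtype.ext; simp
      map_smul' := fun c y => by apply Subtype.ext; simp }
  let B : S.V →ₗ[ℝ] S.V →L[ℝ] S.V :=
    { toFun := fun y => LinearMap.toContinuousLinearMap
        { toFun := fun v => S.br (prW y) v
          map_add' := S.br_add _
          map_smul' := S.br_smul _ }
      map_add' := fun y z => by
        ext1 v
        exact (congrArg (fun K => S.br K v) (map_add prW y z)).trans (S.add_br _ _ _)
      map_smul' := fun c y => by
        ext1 v
        exact (congrArg (fun K => S.br K v) (map_smul prW c y)).trans (S.smul_br _ _ _) }
  refine ⟨B.toContinuousLinearMap, fun L v => ?_⟩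
  change S.br (prW (S.incl L)) v = _
  have h1 : pr (S.incl L) = ⟨S.incl L, L.2⟩ :=
    Submodule.projectionOnto_apply_left hπ ⟨S.incl L, L.2⟩
  have h2 : prW (S.incl L) = L := Subtype.ext (congrArg (fun w : S.W.comap S.V.subtype => ((w : S.V) : VField n)) h1)
  rw [h2]

/-- Product rule for the bracket of a curve in `W` with a curve in `V`. -/
theorem hasDerivAt_br {Y Z : S.Family} {t : ℝ} (hY : ∀ t, Y.field t ∈ S.W) :
    HasDerivAt (fun s => S.br ⟨Y.field s, hY s⟩ (Z s))
      (S.br ⟨Y.deriv.field t, Y.deriv_mem hY t⟩ (Z t) + S.br ⟨Y.field t, hY t⟩ (Z.deriv t)) t := by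
  obtain ⟨B, hB⟩ := S.exists_bracket_extension
  simp only [← hB]
  exact (B.hasFDerivAt.comp_hasDerivAt t (Y.hasDerivAt t)).clm_apply (Z.hasDerivAt t)

/-! ### Push-forward of curves along a generalised flow. -/

variable {S} {Y : S.Family} {g : ℝ → Diffeo n}

/-- The curve `t ↦ g_{t*} X_t` in `V`. -/
noncomputable def pushFamily (hY : ∀ t, Y.field t ∈ S.W) (hg : IsGeneralisedFlow Y.field g)
    (X : S.Family) : S.Family :=
  ⟨fun t => ⟨push (g t) (X.field t), S.push_mem hY hg t (X t)⟩, by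
    -- Smoothness is inherited from `g_★ X`, already known to be a smooth curve, by subtracting `Y`.
    have e : (fun t => (⟨push (g t) (X.field t), S.push_mem hY hg t (X t)⟩ : S.V)) =
        fun t => S.star ⟨Y, hY, hg⟩ X t - Y t := by
      funext t
      apply eq_sub_of_add_eq'
      apply Subtype.ext
      ext1 x
      exact ((S.star_field ⟨Y, hY, hg⟩ X t x).trans (starFun_eq hg _ _ _)).symm
    rw [e]
    exact ((S.star ⟨Y, hY, hg⟩ X).contDiff.sub Y.contDiff).contMDiff⟩

theorem star_apply (hY : ∀ t, Y.field t ∈ S.W) (hg : IsGeneralisedFlow Y.field g)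
    (hgW : g ∈ S.groupW) (X : S.Family) (t : ℝ) :
    S.star hgW X t = Y t + pushFamily hY hg X t := by
  apply Subtype.ext
  ext1 x
  exact (S.star_field hgW X t x).trans (starFun_eq hg _ _ _)

/-- `d/dt (g_{t*} X_t) = -[Y_t, g_{t*} X_t] + g_{t*} (dX_t/dt)`. -/
theorem hasDerivAt_pushFamily (hY : ∀ t, Y.field t ∈ S.W) (hg : IsGeneralisedFlow Y.field g)
    (X : S.Family) (t : ℝ) :
    HasDerivAt (pushFamily hY hg X)
      (-S.br ⟨Y.field t, hY t⟩ (pushFamily hY hg X t) + pushFamily hY hg X.deriv t) t := by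
  have key : (pushFamily hY hg X).deriv t =
      -S.br ⟨Y.field t, hY t⟩ (pushFamily hY hg X t) + pushFamily hY hg X.deriv t := by
    apply Subtype.ext
    ext1 y
    -- At the moving point `g_s x` the push-forward equals `Dg_s(x)(X_s(x))`. Both sides are
    -- differentiated in `s`: the left by the total derivative along the trajectory, the right by
    -- the product rule and the variational equation. The two terms in which `Y` occurs form the
    -- bracket.
    obtain ⟨x, rfl⟩ : ∃ x, g t x = y := ⟨(g t).symm y, (g t).apply_symm_apply y⟩
    have h1 := (pushFamily hY hg X).hasDerivAt_along (hg.ode t x)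
    have h2 := (hg.differentiable_fderiv x t).hasDerivAt.clm_apply (X.hasDerivAt_eval t x)
    have e : (fun s => (pushFamily hY hg X).field s (g s x)) =
        fun s => fderiv ℝ (g s) x (X.field s x) :=
      funext fun s => push_apply_self (g s) (X.field s) x
    rw [e] at h1
    have h3 := h1.unique h2
    have h4 := (hasDerivAt_apply_const (hg.differentiable_fderiv x t).hasDerivAt
      (X.field t x)).unique (hg.variational t x (X.field t x))
    rw [h4, ← push_apply_self, ← push_apply_self] at h3
    change (pushFamily hY hg X).deriv.field t (g t x) =
      -(fderiv ℝ ((pushFamily hY hg X).field t) (g t x) (Y.field t (g t x)) -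
        fderiv ℝ (Y.field t) (g t x) (push (g t) (X.field t) (g t x))) +
        push (g t) (X.deriv.field t) (g t x)
    rw [eq_sub_of_add_eq h3]
    abel
  rw [← key]
  exact (pushFamily hY hg X).hasDerivAt t

end Scheme

end QuasiLie

namespace QuasiLie

namespace Scheme

variable {n : ℕ} {S : Scheme n}

/-! ### Jets of curves in `V` -/

/-- By the chain rule, `τ` enters only through `a = τ'(0)` and `b = τ''(0)`, and the coordinates of
the jet are a linear function of `X`, `X'`, `X''`. -/
theorem jet_eq {τ : ℝ → ℝ} (hτ : ContDiff ℝ ∞ τ) (hτ0 : τ 0 = 0) (X : S.Family) (t : ℝ) :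
    S.jet τ X t = (X t, deriv τ 0 • X.deriv t,
      deriv τ 0 ^ 2 • X.deriv.deriv t + iteratedDeriv 2 τ 0 • X.deriv t) := by
  have hτd : ∀ u, HasDerivAt τ (deriv τ u) u := fun u =>
    (hτ.differentiable (by simp) u).hasDerivAt
  have hτdd : HasDerivAt (deriv τ) (deriv (deriv τ) 0) 0 :=
    (((contDiff_infty_iff_deriv.1 hτ).2).differentiable (by simp) 0).hasDerivAt
  have hcomp : ∀ (Z : S.Family) (u : ℝ), HasDerivAt (fun u => Z (t + τ u))
      (deriv τ u • Z.deriv (t + τ u)) u := fun Z u =>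
    (Z.hasDerivAt (t + τ u)).scomp u ((hτd u).const_add t)
  have h1 : deriv (fun u => X (t + τ u)) = fun u => deriv τ u • X.deriv (t + τ u) :=
    funext fun u => (hcomp X u).deriv
  have h2 := (hτdd.smul (hcomp X.deriv 0)).deriv
  have hit : ∀ {E : Type} [NormedAddCommGroup E] [NormedSpace ℝ E] (f : ℝ → E),
      iteratedDeriv 2 f = deriv (deriv f) := fun f => by
    rw [iteratedDeriv_succ, iteratedDeriv_one]
  unfold jet
  rw [hit, hit, h1]
  refine Prod.ext rfl (Prod.ext ?_ ?_)
  · simp [hτ0]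
  · refine h2.trans ?_
    simp only [hτ0, add_zero, smul_smul]
    rw [sq]

/-- Since `a ≠ 0`, the linear change of coordinates in `jet_eq` is invertible, and a quadratic
polynomial in `s - t` realises any triple of derivatives. Invariance on jets of curves is thereby
invariance on all of `T²V`. -/
theorem exists_jet_eq {τ : ℝ → ℝ} (hτ : ContDiff ℝ ∞ τ) (hτ0 : τ 0 = 0) (hτ1 : deriv τ 0 ≠ 0)
    (t : ℝ) (p : S.T2V) : ∃ X : S.Family, S.jet τ X t = p := by
  obtain ⟨p₀, p₁, p₂⟩ := p
  set a := deriv τ 0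
  set b := iteratedDeriv 2 τ 0
  let v₁ : S.V := a⁻¹ • p₁
  let v₂ : S.V := (a ^ 2)⁻¹ • (p₂ - b • v₁)
  have hc : ContDiff ℝ ∞ (fun s : ℝ => p₀ + (s - t) • v₁ + ((s - t) ^ 2 / 2) • v₂) := by
    fun_prop
  let X : S.Family := ⟨_, hc.contMDiff⟩
  have hid : ∀ s, HasDerivAt (fun s : ℝ => s - t) 1 s := fun s => (hasDerivAt_id s).sub_const t
  have h1 : ∀ s, X.deriv s = v₁ + (s - t) • v₂ := fun s => by
    have h := (((hid s).smul_const v₁).const_add p₀).add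
      ((((hid s).pow 2).div_const 2).smul_const v₂)
    refine (X.hasDerivAt s).unique (h.congr_deriv ?_)
    rw [one_smul]
    congr 2
    push_cast
    ring
  have h2 : X.deriv.deriv t = v₂ := by
    have h := ((hid t).smul_const v₂).const_add v₁
    rw [one_smul] at h
    exact (X.deriv.hasDerivAt t).unique (h.congr_of_eventuallyEq (.of_forall h1))
  have h0 : X t = p₀ := by
    change p₀ + (t - t) • v₁ + ((t - t) ^ 2 / 2) • v₂ = p₀
    simp
  refine ⟨X, ?_⟩
  rw [jet_eq hτ hτ0, h0, h1, h2]
  simp only [sub_self, zero_smul, add_zero]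
  change (p₀, a • v₁, a ^ 2 • v₂ + b • v₁) = _
  rw [smul_inv_smul₀ hτ1, smul_inv_smul₀ (pow_ne_zero 2 hτ1), sub_add_cancel]

variable {Y : S.Family} {g : ℝ → Diffeo n}

/-- The jet of `g_★ X` is obtained from the jet of `X` by an element of `𝒥²`, followed by `𝒯₁`
and `𝒯₂`. -/
theorem jet_star {τ : ℝ → ℝ} (hτ : ContDiff ℝ ∞ τ) (hτ0 : τ 0 = 0)
    (hY : ∀ t, Y.field t ∈ S.W) (hg : IsGeneralisedFlow Y.field g) (hgW : g ∈ S.groupW)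
    (X : S.Family) (t : ℝ) {L₀ L₁ L₂ : S.W} (h₀ : S.incl L₀ = Y t) (h₁ : S.incl L₁ = Y.deriv t)
    (h₂ : S.incl L₂ = Y.deriv.deriv t) :
    S.jet τ (S.star hgW X) t =
      S.actT2 (deriv τ 0) (deriv τ 0 • L₁) (deriv τ 0 ^ 2 • L₂ + iteratedDeriv 2 τ 0 • L₁ +
          deriv τ 0 ^ 2 • ⟨⁅(L₁ : VField n), (L₀ : VField n)⁆, S.bracket_WW _ L₁.2 _ L₀.2⟩)
        (S.flowT1 (deriv τ 0) (iteratedDeriv 2 τ 0) L₀ 1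
          (S.actJ (g t) (S.push_mem hY hg t) (S.jet τ X t))) := by
  set a := deriv τ 0
  set b := iteratedDeriv 2 τ 0
  set A : S.Family → S.Family := pushFamily hY hg
  have hL₀ : (⟨Y.field t, hY t⟩ : S.W) = L₀ := Subtype.ext (congrArg Subtype.val h₀).symm
  have hL₁ : (⟨Y.deriv.field t, Y.deriv_mem hY t⟩ : S.W) = L₁ :=
    Subtype.ext (congrArg Subtype.val h₁).symm
  set Z := S.star hgW X
  have hZ0 : ∀ s, Z s = Y s + A X s := star_apply hY hg hgW X
  have hA1 : ∀ (U : S.Family) s,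
      (A U).deriv s = -S.br ⟨Y.field s, hY s⟩ (A U s) + A U.deriv s := fun U s =>
    ((A U).hasDerivAt s).unique (hasDerivAt_pushFamily hY hg U s)
  have hZ1 : ∀ s, Z.deriv s =
      Y.deriv s + (-S.br ⟨Y.field s, hY s⟩ (A X s) + A X.deriv s) := fun s =>
    (Z.hasDerivAt s).unique (((Y.hasDerivAt s).add
      (hasDerivAt_pushFamily hY hg X s)).congr_of_eventuallyEq (.of_forall hZ0))
  -- The term `[Y, g_* X']` arises twice, once from the product rule for `[Y, g_* X]` and once from
  -- differentiating `g_* X'`; hence the factor `2` in `𝒯₁`.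
  have hZ2 : Z.deriv.deriv t = Y.deriv.deriv t +
      (-(S.br L₁ (A X t) + S.br L₀ (-S.br L₀ (A X t) + A X.deriv t)) +
        (-S.br L₀ (A X.deriv t) + A X.deriv.deriv t)) := by
    have h := (Y.deriv.hasDerivAt t).add (((S.hasDerivAt_br (Z := A X) (t := t) hY).neg).add
      (hasDerivAt_pushFamily hY hg X.deriv t))
    rw [hA1, hL₀, hL₁] at h
    exact (Z.deriv.hasDerivAt t).unique (h.congr_of_eventuallyEq (.of_forall hZ1))
  have hpush : ∀ (U : S.Family) (v : S.V) (hv : U t = v),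
      (⟨push (g t) v, S.push_mem hY hg t v⟩ : S.V) = A U t := fun U v hv => by
    subst hv; rfl
  have hJ : S.actJ (g t) (S.push_mem hY hg t) (S.jet τ X t) =
      (A X t, a • A X.deriv t, a ^ 2 • A X.deriv.deriv t + b • A X.deriv t) := by
    -- Push-forward is linear, so it commutes with the coordinate change of `jet_eq`.
    have hlin : ∀ (c d : ℝ) (u v : S.V),
        (⟨push (g t) (c • u + d • v : S.V), S.push_mem hY hg t _⟩ : S.V) =
        c • (⟨push (g t) u, S.push_mem hY hg t _⟩ : S.V) +
          d • ⟨push (g t) v, S.push_mem hY hg t _⟩ := by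
      intro c d u v
      apply Subtype.ext
      ext1 x
      change fderiv ℝ (g t) _ (c • (u : VField n) _ + d • (v : VField n) _) = _
      rw [map_add, map_smul, map_smul]
      rfl
    rw [jet_eq hτ hτ0]
    refine Prod.ext rfl (Prod.ext ?_ (hlin _ _ _ _))
    have h := hlin a 0 (X.deriv t) 0
    simp only [zero_smul, add_zero] at h
    exact h
  rw [hJ, jet_eq hτ hτ0, hZ0, hZ1, hZ2, hL₀, ← h₀, ← h₁, ← h₂]
  have i1 : ∀ (c : ℝ) (K : S.W), S.incl (c • K) = c • S.incl K := fun _ _ => rfl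
  have i2 : ∀ K K' : S.W, S.incl (K + K') = S.incl K + S.incl K' := fun _ _ => rfl
  -- `𝒯₂` acts after `𝒯₁` has moved the base point to `g_* X + L₀`, so its bracket term produces an
  -- unwanted `-a²[L₁, L₀]`. The summand `a²[L₁, L₀]` in the last argument of `actT2` cancels it; it
  -- lies in `W` because `[W, W] ⊆ W`.
  have i3 : S.incl ⟨⁅(L₁ : VField n), (L₀ : VField n)⁆, S.bracket_WW _ L₁.2 _ L₀.2⟩ =
      S.br L₁ (S.incl L₀) := rfl
  have i4 : ∀ (K : S.W) (v : S.V), S.br K (-v) = -S.br K v := fun K v => by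
    simpa using S.br_smul K (-1) v
  refine Prod.ext ?_ (Prod.ext ?_ ?_)
  · simp only [actT2, flowT1, Prod.fst_add]
    module
  · simp only [actT2, flowT1, Prod.fst_add, Prod.snd_add, i1]
    module
  · simp only [actT2, flowT1, Prod.fst_add, Prod.snd_add, i1, i2, i3, i4, br_add, br_smul,
      smul_br]
    module

/-! ### The generators -/

variable (S)

theorem hasDerivAt_actT (Y : S.W) (p : S.T2V) (s : ℝ) :
    HasDerivAt (fun s : ℝ => S.actT (s • Y) p) (0, 0, S.incl Y) s := by
  have h : HasDerivAt (fun s : ℝ => p.2.2 + s • S.incl Y) (S.incl Y) s := by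
    simpa using! ((hasDerivAt_id s).smul_const (S.incl Y)).const_add p.2.2
  exact (hasDerivAt_const s p.1).prodMk ((hasDerivAt_const s p.2.1).prodMk h)

theorem hasDerivAt_actT2 (a : ℝ) (Y₁ Y₂ : S.W) (p : S.T2V) (s : ℝ) :
    HasDerivAt (fun s : ℝ => S.actT2 a (s • Y₁) (s • Y₂) p)
      (0, S.incl Y₁, -a • S.br Y₁ p.1 + S.incl Y₂) s := by
  have h1 : HasDerivAt (fun s : ℝ => S.incl (s • Y₁) + p.2.1) (S.incl Y₁) s := by
    simpa using! ((hasDerivAt_id s).smul_const (S.incl Y₁)).add_const p.2.1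
  have h2 : HasDerivAt (fun s : ℝ => -a • S.br (s • Y₁) p.1 + p.2.2 + S.incl (s • Y₂))
      (-a • S.br Y₁ p.1 + S.incl Y₂) s := by
    simp only [smul_br]
    simpa using! ((((hasDerivAt_id s).smul_const (S.br Y₁ p.1)).const_smul (-a)).add_const
      p.2.2).add ((hasDerivAt_id s).smul_const (S.incl Y₂))
  exact (hasDerivAt_const s p.1).prodMk (h1.prodMk h2)

/-- The velocity is needed at every `s`, not only at `0`, in order to compare it with the generator
along the orbit. -/
theorem hasDerivAt_flowT1 (a b : ℝ) (L : S.W) (p : S.T2V) (s : ℝ) :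
    HasDerivAt (fun s : ℝ => S.flowT1 a b L s p)
      (S.incl L, -a • S.br L p.1,
        (2 * s * a ^ 2) • S.br L (S.br L p.1) - (2 * a) • S.br L p.2.1 - b • S.br L p.1) s := by
  have hid := hasDerivAt_id s
  have h1 := hid.smul_const (S.incl L)
  have h2 := (hid.mul_const a).neg.smul_const (S.br L p.1)
  have h3 := (((((hid.pow 2).mul_const (a ^ 2)).smul_const (S.br L (S.br L p.1))).sub
    (((hid.const_mul 2).mul_const a).smul_const (S.br L p.2.1))).sub
      ((hid.const_mul b).smul_const (S.br L p.1)))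
  refine ((h1.prodMk (h2.prodMk h3)).const_add p).congr_deriv ?_
  refine Prod.ext ?_ (Prod.ext ?_ ?_) <;> simp

/-- The velocity depends only on `Y_t` and the current point `q`. It therefore agrees with that of
the flow of the frozen field `Y_t`, which is what makes a time-dependent `Y` tractable. -/
theorem hasDerivAt_actJ {Y : S.Family} {g : ℝ → Diffeo n} (hY : ∀ t, Y.field t ∈ S.W)
    (hg : IsGeneralisedFlow Y.field g) (p : S.T2V) (t : ℝ) {L : S.W} (hL : S.incl L = Y t)
    {q : S.T2V} (hq : S.actJ (g t) (S.push_mem hY hg t) p = q) :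
    HasDerivAt (fun t => S.actJ (g t) (S.push_mem hY hg t) p)
      (-S.br L q.1, -S.br L q.2.1, -S.br L q.2.2) t := by
  subst hq
  have hL' : (⟨Y.field t, hY t⟩ : S.W) = L := Subtype.ext (congrArg Subtype.val hL).symm
  have h : ∀ v : S.V, HasDerivAt (fun t => (⟨push (g t) v, S.push_mem hY hg t v⟩ : S.V))
      (-S.br L ⟨push (g t) v, S.push_mem hY hg t v⟩) t := fun v => by
    have h1 := hasDerivAt_pushFamily hY hg ⟨fun _ => v, contMDiff_const⟩ t
    have h2 : (pushFamily hY hg (Family.deriv ⟨fun _ => v, contMDiff_const⟩)) t = 0 := by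
      apply Subtype.ext
      ext1 x
      have h3 : (Family.deriv (S := S) ⟨fun _ => v, contMDiff_const⟩) t = 0 := deriv_const t v
      change fderiv ℝ (g t) _ (((Family.deriv (S := S) ⟨fun _ => v, contMDiff_const⟩ t : S.V) :
        VField n) _) = 0
      rw [h3]
      exact map_zero _
    rw [h2, add_zero, hL'] at h1
    exact h1
  exact (h p.1).prodMk ((h p.2.1).prodMk (h p.2.2))

theorem hasDerivAt_flowJ (L : S.W) {h : ℝ → Diffeo n} (hh : IsFlow (L : VField n) h) (p : S.T2V) :
    HasDerivAt (fun s => S.flowJ L hh s p) (-S.br L p.1, -S.br L p.2.1, -S.br L p.2.2) 0 :=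
  S.hasDerivAt_actJ (Y := ⟨fun _ => S.incl L, contMDiff_const⟩) (fun _ => L.2) hh p 0 rfl
    (Prod.ext (Subtype.ext (hh.push_zero _)) (Prod.ext (Subtype.ext (hh.push_zero _))
      (Subtype.ext (hh.push_zero _))))

theorem flowJ_zero (L : S.W) {h : ℝ → Diffeo n} (hh : IsFlow (L : VField n) h) (p : S.T2V) :
    S.flowJ L hh 0 p = p :=
  Prod.ext (Subtype.ext (hh.push_zero _)) (Prod.ext (Subtype.ext (hh.push_zero _))
    (Subtype.ext (hh.push_zero _)))

theorem flowT1_zero (a b : ℝ) (L : S.W) (p : S.T2V) : S.flowT1 a b L 0 p = p := by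
  refine Prod.ext ?_ (Prod.ext ?_ ?_) <;> simp [flowT1]

/-- The formula is homogeneous in `(s, L)`. This converts the time-one maps of `jet_star` into maps
at arbitrary time. -/
theorem flowT1_smul (a b c : ℝ) (L : S.W) (p : S.T2V) :
    S.flowT1 a b (c • L) 1 p = S.flowT1 a b L c p := by
  have i1 : S.incl (c • L) = c • S.incl L := rfl
  refine Prod.ext ?_ (Prod.ext ?_ ?_) <;> simp only [flowT1, i1, smul_br, br_smul, Prod.fst_add,
    Prod.snd_add] <;> module

theorem actT2_zero (a : ℝ) (p : S.T2V) : S.actT2 a 0 0 p = p := by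
  have h := S.smul_br 0 0 p.1
  rw [zero_smul, zero_smul] at h
  have i : S.incl 0 = 0 := rfl
  refine Prod.ext ?_ (Prod.ext ?_ ?_) <;> simp [actT2, h, i]

variable {S} {φ : S.T2V → ℝ}

/-! ### First integrals are invariant along flows -/

theorem apply_eq_of_fderiv_eq_zero (hφ : ContDiff ℝ ∞ φ) {c c' : ℝ → S.T2V}
    (hc : ∀ s, HasDerivAt c (c' s) s) (h : ∀ s, fderiv ℝ φ (c s) (c' s) = 0) (s t : ℝ) :
    φ (c s) = φ (c t) := by
  have hd : ∀ s, HasDerivAt (fun s => φ (c s)) 0 s := fun s => by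
    have h1 := ((hφ.differentiable (by simp) (c s)).hasFDerivAt).comp_hasDerivAt s (hc s)
    rw [h] at h1
    exact h1
  exact is_const_of_deriv_eq_zero (fun s => (hd s).differentiableAt) (fun s => (hd s).deriv) s t

/-- The velocity of the orbit involves the point only through its first component, which `𝒯₂` fixes;
so the orbit is an integral curve of the generator. -/
theorem IsFirstIntegralT2.apply_actT2 {a : ℝ} (h : S.IsFirstIntegralT2 a φ)
    (hφ : ContDiff ℝ ∞ φ) (Y₁ Y₂ : S.W) (p : S.T2V) : φ (S.actT2 a Y₁ Y₂ p) = φ p := by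
  have h1 := apply_eq_of_fderiv_eq_zero hφ (S.hasDerivAt_actT2 a Y₁ Y₂ p) (fun s => by
    have := h Y₁ Y₂ (S.actT2 a (s • Y₁) (s • Y₂) p)
    rwa [generator, (S.hasDerivAt_actT2 a Y₁ Y₂ _ 0).deriv] at this) 1 0
  simpa only [one_smul, zero_smul, actT2_zero] using h1

theorem IsFirstIntegralT1.apply_flowT1 {a b : ℝ} (h : S.IsFirstIntegralT1 a b φ)
    (hφ : ContDiff ℝ ∞ φ) (L : S.W) (s : ℝ) (p : S.T2V) : φ (S.flowT1 a b L s p) = φ p := by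
  have h1 := apply_eq_of_fderiv_eq_zero hφ (S.hasDerivAt_flowT1 a b L p) (fun s => by
    have := h L (S.flowT1 a b L s p)
    rw [generator, (S.hasDerivAt_flowT1 a b L _ 0).deriv] at this
    -- The velocity at `s` is the generator at `𝒯₁^L(s, p)`: the shift `sL` drops out since `[L, L]
    -- = 0`, and the shift `-sa[L, X]` of the second component yields the derivative of the
    -- quadratic term.
    convert this using 2
    refine Prod.ext rfl (Prod.ext ?_ ?_)
    · simp only [flowT1, Prod.fst_add, br_add, br_smul, br_self]
      module
    · simp only [flowT1, Prod.fst_add, Prod.snd_add, br_add, br_smul, br_self]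
      module) s 0
  rwa [flowT1_zero] at h1

theorem IsFirstIntegralJ.apply_actJ (h : S.IsFirstIntegralJ φ)
    (hW : ∀ L ∈ S.W, IsComplete L) (hφ : ContDiff ℝ ∞ φ) {Y : S.Family} {g : ℝ → Diffeo n}
    (hY : ∀ t, Y.field t ∈ S.W) (hg : IsGeneralisedFlow Y.field g) (t : ℝ) (p : S.T2V) :
    φ (S.actJ (g t) (S.push_mem hY hg t) p) = φ p := by
  have h1 := apply_eq_of_fderiv_eq_zero hφ
    (fun t => S.hasDerivAt_actJ hY hg p t (L := ⟨Y.field t, hY t⟩) rfl rfl) (fun s => by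
      -- Completeness of the frozen field `Y_s` supplies the one-parameter group whose fundamental
      -- vector field is the velocity at time `s`.
      obtain ⟨f, hf⟩ := hW _ (hY s)
      have := h ⟨Y.field s, hY s⟩ f hf (S.actJ (g s) (S.push_mem hY hg s) p)
      rwa [generator, (S.hasDerivAt_flowJ _ hf _).deriv] at this) t 0
  rw [h1]
  exact congrArg φ (Prod.ext (Subtype.ext (hg.push_zero _))
    (Prod.ext (Subtype.ext (hg.push_zero _)) (Subtype.ext (hg.push_zero _))))

/-! ### Invariants are first integrals -/

theorem isFirstIntegral_generator (hφ : ContDiff ℝ ∞ φ) {A : ℝ → S.T2V → S.T2V}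
    (hA : ∀ p, DifferentiableAt ℝ (fun s => A s p) 0) (h0 : ∀ p, A 0 p = p)
    (h : ∀ s p, φ (A s p) = φ p) : S.IsFirstIntegral φ (S.generator A) := fun p => by
  have h1 := ((hφ.differentiable (by simp) (A 0 p)).hasFDerivAt).comp_hasDerivAt 0
    (hA p).hasDerivAt
  have e : (φ ∘ fun s => A s p) = fun _ => φ p := funext fun s => h s p
  rw [e, h0] at h1
  exact h1.unique (hasDerivAt_const _ _)

/-- Invariance of `φ` under the transformations of jets induced by reparametrised flows. -/
theorem IsQuasiLieInvariant.apply_actT2_flowT1_flowJ {τ : ℝ → ℝ} (hτ : ContDiff ℝ ∞ τ)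
    (hτ0 : τ 0 = 0) (hτ1 : deriv τ 0 ≠ 0) {F : S.Family → C^∞⟮𝓘(ℝ, ℝ), ℝ; ℝ⟯}
    (hF : ∀ (X : S.Family) (t : ℝ), F X t = φ (S.jet τ X t)) (hinv : S.IsQuasiLieInvariant F)
    (L : S.W) {h : ℝ → Diffeo n} (hh : IsFlow (L : VField n) h) (c₀ c₁ c₂ c₃ : ℝ) (p : S.T2V) :
    φ (S.actT2 (deriv τ 0) (c₂ • L) (c₃ • L)
      (S.flowT1 (deriv τ 0) (iteratedDeriv 2 τ 0) L c₁ (S.flowJ L hh c₀ p))) = φ p := by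
  set a := deriv τ 0 with ha
  set b := iteratedDeriv 2 τ 0
  -- a polynomial vanishing at `0` with prescribed Taylor coefficients at `1`
  let d₂ : ℝ := c₂ / a
  let d₃ : ℝ := (c₃ - b * d₂) / a ^ 2
  -- The quartic term does not affect the Taylor coefficients at `1` up to order three, so it is
  -- free to enforce `σ 0 = 0`. The values `d₂`, `d₃` solve `a d₂ = c₂` and `a² d₃ + b d₂ = c₃`.
  let d₄ : ℝ := -(c₀ - c₁ + d₂ / 2 - d₃ / 6)
  let σ : ℝ → ℝ := fun t =>
    c₀ + c₁ * (t - 1) + d₂ / 2 * (t - 1) ^ 2 + d₃ / 6 * (t - 1) ^ 3 + d₄ * (t - 1) ^ 4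
  let σ₁ : ℝ → ℝ := fun t =>
    c₁ + d₂ * (t - 1) + d₃ / 2 * (t - 1) ^ 2 + 4 * d₄ * (t - 1) ^ 3
  let σ₂ : ℝ → ℝ := fun t => d₂ + d₃ * (t - 1) + 12 * d₄ * (t - 1) ^ 2
  have hid : ∀ s, HasDerivAt (fun s : ℝ => s - 1) 1 s := fun s => (hasDerivAt_id s).sub_const 1
  have hσ1 : ∀ t, HasDerivAt σ (σ₁ t) t := fun t => by
    refine ((((((hid t).const_mul c₁).const_add c₀).add (((hid t).pow 2).const_mul (d₂ / 2))).add
      (((hid t).pow 3).const_mul (d₃ / 6))).add (((hid t).pow 4).const_mul d₄)).congr_deriv ?_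
    simp only [σ₁]; push_cast; ring
  have hσ2 : ∀ t, HasDerivAt σ₁ (σ₂ t) t := fun t => by
    refine (((((hid t).const_mul d₂).const_add c₁).add (((hid t).pow 2).const_mul (d₃ / 2))).add
      (((hid t).pow 3).const_mul (4 * d₄))).congr_deriv ?_
    simp only [σ₂]; push_cast; ring
  have hσ3 : HasDerivAt σ₂ d₃ 1 := by
    refine ((((hid 1).const_mul d₃).const_add d₂).add
      (((hid 1).pow 2).const_mul (12 * d₄))).congr_deriv ?_
    push_cast; ring
  have hσ0 : σ 0 = 0 := by simp only [σ, d₄]; ring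
  have hσs : ContDiff ℝ ∞ σ := by fun_prop
  have hσ1s : ContDiff ℝ ∞ σ₁ := by fun_prop
  let Y : S.Family := ⟨fun t => σ₁ t • S.incl L, (hσ1s.smul contDiff_const).contMDiff⟩
  have hY : ∀ t, Y.field t ∈ S.W := fun t => S.W.smul_mem _ L.2
  have hg : IsGeneralisedFlow Y.field (fun t => h (σ t)) :=
    IsGeneralisedFlow.reparam hh hσs hσ0 hσ1
  have hY1 : ∀ t, Y.deriv t = σ₂ t • S.incl L := fun t =>
    (Y.hasDerivAt t).unique ((hσ2 t).smul_const _)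
  have hY2 : Y.deriv.deriv 1 = d₃ • S.incl L :=
    (Y.deriv.hasDerivAt 1).unique ((hσ3.smul_const _).congr_of_eventuallyEq (.of_forall hY1))
  have hσ_one : σ 1 = c₀ := by simp [σ]
  have hσ1_one : σ₁ 1 = c₁ := by simp [σ₁]
  have hσ2_one : σ₂ 1 = d₂ := by simp [σ₂]
  obtain ⟨X, hX⟩ := exists_jet_eq hτ hτ0 hτ1 1 p
  have hjet := jet_star hτ hτ0 hY hg ⟨Y, hY, hg⟩ X 1 (L₀ := c₁ • L) (L₁ := d₂ • L)
    (L₂ := d₃ • L) (by rw [← hσ1_one]; rfl) (by rw [hY1, hσ2_one]; rfl) (by rw [hY2]; rfl)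
  -- At time `1` both `Y` and `Y'` are multiples of `L`, so the correcting bracket of `jet_star`
  -- vanishes.
  have hbr : (⟨⁅((d₂ • L : S.W) : VField n), ((c₁ • L : S.W) : VField n)⁆,
      S.bracket_WW _ (d₂ • L).2 _ (c₁ • L).2⟩ : S.W) = 0 := by
    have h1 : S.br (d₂ • L) (c₁ • S.incl L) = 0 := by
      rw [smul_br, br_smul, br_self, smul_zero, smul_zero]
    exact Subtype.ext (congrArg (fun v : S.V => (v : VField n)) h1)
  have e1 : a • d₂ • L = c₂ • L := by
    rw [smul_smul, mul_div_cancel₀ _ hτ1]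
  have e2 : a ^ 2 • d₃ • L + b • d₂ • L = c₃ • L := by
    rw [smul_smul, smul_smul, ← add_smul, mul_div_cancel₀ _ (pow_ne_zero 2 hτ1), sub_add_cancel]
  have hJ : S.actJ (h (σ 1)) (S.push_mem hY hg 1) p = S.flowJ L hh c₀ p := by
    simp only [hσ_one]; rfl
  have hFX := congrArg (fun f => f 1) (hinv _ ⟨Y, hY, hg⟩ X)
  simp only [hF] at hFX
  rw [hjet, hbr, ← ha, smul_zero, add_zero, e1, e2, flowT1_smul, hX, hJ] at hFX
  exact hFX

end Scheme

end QuasiLie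

/-! ### The characterisation of invariants of order two. -/

theorem mainTheorem4 {n : ℕ} (S : QuasiLie.Scheme n)
    (hW : ∀ L ∈ S.W, QuasiLie.IsComplete L)
    (τ : ℝ → ℝ) (hτ : ContDiff ℝ ∞ τ) (hτ0 : τ 0 = 0) (hτ1 : deriv τ 0 ≠ 0)
    (F : S.Family → C^∞⟮𝓘(ℝ, ℝ), ℝ; ℝ⟯)
    (φ : S.T2V → ℝ) (hφ : ContDiff ℝ ∞ φ)
    (hF : ∀ (X : S.Family) (t : ℝ), F X t = φ (S.jet τ X t)) :
    S.IsQuasiLieInvariantOfOrderTwo F ↔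
      S.IsFirstIntegralJ φ ∧ S.IsFirstIntegralT φ ∧
        S.IsFirstIntegralT1 (deriv τ 0) (iteratedDeriv 2 τ 0) φ ∧
        S.IsFirstIntegralT2 (deriv τ 0) φ := by
  open QuasiLie QuasiLie.Scheme in
  constructor
  · rintro ⟨hinv, -⟩
    have key : ∀ (L : S.W) {h : ℝ → Diffeo n} (hh : IsFlow (L : VField n) h) (c₀ c₁ c₂ c₃ : ℝ)
        (p : S.T2V), _ := fun L _ hh =>
      IsQuasiLieInvariant.apply_actT2_flowT1_flowJ hτ hτ0 hτ1 hF hinv L hh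
    have keyT2 : ∀ (L : S.W) (c₂ c₃ : ℝ) (p : S.T2V),
        φ (S.actT2 (deriv τ 0) (c₂ • L) (c₃ • L) p) = φ p := fun L c₂ c₃ p => by
      obtain ⟨h, hh⟩ := hW L L.2
      have := key L hh 0 0 c₂ c₃ p
      rwa [flowJ_zero, flowT1_zero] at this
    have hT : S.IsFirstIntegralT φ := fun Y => by
      refine isFirstIntegral_generator hφ (fun p => (S.hasDerivAt_actT Y p 0).differentiableAt)
        (fun p => ?_) (fun s p => ?_)
      · have i : S.incl 0 = 0 := rfl
        simp [actT, i]
      · have h := keyT2 Y 0 s p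
        have i : S.incl 0 = 0 := rfl
        have e : S.actT2 (deriv τ 0) ((0 : ℝ) • Y) (s • Y) p = S.actT (s • Y) p := by
          refine Prod.ext rfl (Prod.ext ?_ ?_) <;> simp only [actT2, actT, smul_br] <;> simp [i]
        rwa [e] at h
    refine ⟨fun L h hh => ?_, hT, fun L => ?_, fun Y₁ Y₂ p => ?_⟩
    · refine isFirstIntegral_generator hφ (fun p => (S.hasDerivAt_flowJ L hh p).differentiableAt)
        (S.flowJ_zero L hh) (fun s p => ?_)
      have := key L hh s 0 0 0 p
      rwa [flowT1_zero, zero_smul, actT2_zero] at this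
    · refine isFirstIntegral_generator hφ
        (fun p => (S.hasDerivAt_flowT1 _ _ L p 0).differentiableAt)
        (S.flowT1_zero _ _ L) (fun s p => ?_)
      obtain ⟨h, hh⟩ := hW L L.2
      have := key L hh 0 s 0 0 p
      rwa [flowJ_zero, zero_smul, actT2_zero] at this
    -- Invariance is available only for `Y₁`, `Y₂` proportional to a common `L`. The general
    -- generator is the sum of the one for `(Y₁, 0)` and the field of `𝒯²` for `Y₂`.
    · have h1 : S.IsFirstIntegral φ
          (S.generator fun s => S.actT2 (deriv τ 0) (s • Y₁) (s • (0 : S.W))) := by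
        refine isFirstIntegral_generator hφ
          (fun p => (S.hasDerivAt_actT2 _ Y₁ 0 p 0).differentiableAt) (fun p => ?_)
          (fun s p => ?_)
        · rw [zero_smul, zero_smul, actT2_zero]
        · have := keyT2 Y₁ s 0 p
          rwa [zero_smul, ← smul_zero (A := S.W) s] at this
      have h1p := h1 p
      have h2p := hT Y₂ p
      rw [generator, (S.hasDerivAt_actT2 _ _ _ p 0).deriv] at h1p ⊢
      rw [generator, (S.hasDerivAt_actT _ p 0).deriv] at h2p
      have e : ((0, S.incl Y₁, -deriv τ 0 • S.br Y₁ p.1 + S.incl Y₂) : S.T2V) =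
          (0, S.incl Y₁, -deriv τ 0 • S.br Y₁ p.1 + S.incl 0) + (0, 0, S.incl Y₂) := by
        have i : S.incl 0 = 0 := rfl
        simp [i]
      rw [e, map_add, h1p, h2p, add_zero]
  · rintro ⟨hJ, -, hT1, hT2⟩
    refine ⟨?_, ?_⟩
    · rintro g hg X
      obtain ⟨Y, hY, hflow⟩ := id hg
      ext t
      rw [hF, hF, jet_star hτ hτ0 hY hflow hg X t (L₀ := ⟨Y.field t, hY t⟩)
        (L₁ := ⟨Y.deriv.field t, Y.deriv_mem hY t⟩)
        (L₂ := ⟨Y.deriv.deriv.field t, Y.deriv.deriv_mem (Y.deriv_mem hY) t⟩) rfl rfl rfl,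
        hT2.apply_actT2 hφ, hT1.apply_flowT1 hφ, hJ.apply_actJ hW hφ hY hflow]
    -- The definition of order two uses the parameter `t` itself, so `φ` is composed with the
    -- coordinate change from `τ = id` to the given `τ`.
    · refine ⟨fun q => φ (q.1, deriv τ 0 • q.2.1,
        deriv τ 0 ^ 2 • q.2.2 + iteratedDeriv 2 τ 0 • q.2.1), ?_, fun X t => ?_⟩
      · exact hφ.comp (by fun_prop)
      · have hid : iteratedDeriv 2 (id : ℝ → ℝ) 0 = 0 := by
          rw [iteratedDeriv_succ, iteratedDeriv_one]
          simp
        rw [hF, jet_eq hτ hτ0, jet_eq contDiff_id rfl, hid]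
        simp
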